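/- Korn's inequality, and the failure of a pointwise coercivity condition. Let $n\ge 1$. (1) (Korn's inequality) For every $p\in(1,\infty)$ there is a constant $C=C(n,p)<\infty$ such that for all $u=(u_1,\dots,u_n)\in C_c^\infty(\mathbb R^n;\mathbb C^n)$ $$\sum_{i,j=1}^n\|\partial_i u_j\|_{L^p(\mathbb R^n)}\le C\sum_{i,j=1}^n\|\partial_i u_j+\partial_j u_i\|_{L^p(\mathbb R^n)}.$$ For (2)-(4), identify $\mathbb C^n\otimes\mathbb C^n$ with the arrays $w=(w_{ij})_{i,j=1}^n$ with the Euclidean norm $|w|^2=\sum_{i,j}|w_{ij}|^2$. Let $D=-i\sum_{j=1}^n\hat D_j\partial_j$ with $\hat D_jv=i\,e_j\otimes v$ for $v\in\mathbb C^n$, let $\hat D(\xi)=\sum_j\xi_j\hat D_j$ be its symbol, and let $A$ be the symmetrizer $(Aw)_{ij}=w_{ij}+w_{ji}$. Thus $D=\nabla\otimes$, and for $u\in C_c^\infty(\mathbb R^n;\mathbb C^n)$ one has $(Du)_{ij}=\partial_iu_j$ and $(ADu)_{ij}=\partial_iu_j+\partial_ju_i$. (2) (Symbol) The range of $\hat D(\xi)$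 has dimension $n$ for every $\xi\in\mathbb R^n\setminus\{0\}$. For all $\xi\in\mathbb R^n$ and $v\in\mathbb C^n$, $$|A\hat D(\xi)v|^2=2\big(|\xi|^2|v|^2+|\xi\cdot v|^2\big),\qquad |\hat D(\xi)v|^2=|\xi|^2|v|^2,\qquad\text{where } \xi\cdot v=\sum_i\xi_iv_i,$$ so $|A\hat D(\xi)v|^2\ge 2|\hat D(\xi)v|^2$; in particular there is $c>0$ with $|A\hat D(\xi)v|\ge c|\hat D(\xi)v|$ for all $\xi$ and $v$. (3) (Coercivity) For every $p\in(1,\infty)$ there is $C<\infty$ with $\|Du\|_{L^p}\le C\|ADu\|_{L^p}$ for all $u\in C_c^\infty(\mathbb R^n;\mathbb C^n)$. (4) (The pointwise condition is not necessary) Every $w\in\mathbb C^n\otimes\mathbb C^n$ has the form $\sum_j\hat D_jv_j$ with $v_1,\dots,v_n\in\mathbb C^n$, and $Aw=0$ for every antisymmetric $w$ ($w_{ji}=-w_{ij}$ for all $i,j$). If $n\ge2$, then there is no $c>0$ such that $$\Big|A\sum_{j=1}^n\hat D_jv_j\Big|\ge c\,\Big|\sum_{j=1}^n\hat D_jv_j\Big|\qquad\text{for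 all }v_1,\dots,v_n\in\mathbb C^n,$$ although by (3) the coercivity estimate holds for all $p\in(1,\infty)$. -/

import Mathlib

open MeasureTheory
open scoped ENNReal NNReal ContDiff

noncomputable section

namespace Coercivity

/-- The Euclidean space `ℝⁿ`. -/
abbrev RSpace (n : ℕ) : Type := EuclideanSpace ℝ (Fin n)

/-- The Hermitian space `ℂ^ν`, with coordinates indexed by a finite type `ν`. -/
abbrev CSpace (ν : Type) : Type := EuclideanSpace ℂ ν

/-- The partial derivative `∂ᵢ f` of a function on `ℝⁿ`. -/
def pderiv {n : ℕ} {F : Type} [NormedAddCommGroup F] [NormedSpace ℝ F]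
    (i : Fin n) (f : RSpace n → F) (x : RSpace n) : F :=
  fderiv ℝ f x (EuclideanSpace.single i (1 : ℝ))

/-- Test functions: smooth and compactly supported functions on `ℝⁿ`. -/
structure IsTestFunction {n : ℕ} {F : Type} [NormedAddCommGroup F] [NormedSpace ℝ F]
    (u : RSpace n → F) : Prop where
  smooth : ContDiff ℝ ∞ u
  compactSupport : HasCompactSupport u

section General

variable {n : ℕ} {ν μ κ : Type} [Fintype ν] [Fintype μ] [Fintype κ]

/-- The constant-coefficient first order operator `D = -i ∑ⱼ D̂ⱼ ∂ⱼ` with coefficients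
`D̂ⱼ ∈ L(ℂ^ν, ℂ^μ)`. -/
def diffOp (Dhat : Fin n → CSpace ν →L[ℂ] CSpace μ) (u : RSpace n → CSpace ν)
    (x : RSpace n) : CSpace μ :=
  (-Complex.I) • ∑ j, Dhat j (pderiv j u x)

/-- The symbol `D̂(ξ) = ∑ⱼ ξⱼ D̂ⱼ`. -/
def symbol (Dhat : Fin n → CSpace ν →L[ℂ] CSpace μ) (ξ : RSpace n) :
    CSpace ν →L[ℂ] CSpace μ :=
  ∑ j, (ξ j : ℂ) • Dhat j

/-- The range of the symbol has the same dimension `r` at all non-zero frequencies. -/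
def HasConstantRank (Dhat : Fin n → CSpace ν →L[ℂ] CSpace μ) (r : ℕ) : Prop :=
  ∀ ξ : RSpace n, ξ ≠ 0 →
    Module.finrank ℂ (LinearMap.range (symbol Dhat ξ).toLinearMap) = r

/-- The coercivity estimate `‖Du‖ₚ ≲ ‖ADu‖ₚ` for all test functions `u`. -/
def LpCoercive (p : ℝ≥0∞) (A : RSpace n → CSpace μ →L[ℂ] CSpace κ)
    (Dhat : Fin n → CSpace ν →L[ℂ] CSpace μ) : Prop :=
  ∃ C : ℝ≥0, ∀ u : RSpace n → CSpace ν, IsTestFunction u →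
    eLpNorm (diffOp Dhat u) p volume ≤ C * eLpNorm (fun x => A x (diffOp Dhat u x)) p volume

/-- The symbol condition `|A(x) D̂(ξ) v| ≳ |D̂(ξ) v|`, uniformly in `x` (almost everywhere),
`ξ` and `v`. -/
def SymbolCoercive (A : RSpace n → CSpace μ →L[ℂ] CSpace κ)
    (Dhat : Fin n → CSpace ν →L[ℂ] CSpace μ) : Prop :=
  ∃ c : ℝ, 0 < c ∧ ∀ᵐ x ∂(volume : Measure (RSpace n)), ∀ (ξ : RSpace n) (v : CSpace ν),
    c * ‖symbol Dhat ξ v‖ ≤ ‖A x (symbol Dhat ξ v)‖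

/-- The pointwise condition `|A(x) ∑ⱼ D̂ⱼ vⱼ| ≳ |∑ⱼ D̂ⱼ vⱼ|`, uniformly in `x` (almost
everywhere) and in `v₁, …, vₙ`. -/
def PointwiseCoercive (A : RSpace n → CSpace μ →L[ℂ] CSpace κ)
    (Dhat : Fin n → CSpace ν →L[ℂ] CSpace μ) : Prop :=
  ∃ c : ℝ, 0 < c ∧ ∀ᵐ x ∂(volume : Measure (RSpace n)), ∀ v : Fin n → CSpace ν,
    c * ‖∑ j, Dhat j (v j)‖ ≤ ‖A x (∑ j, Dhat j (v j))‖

end General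

/-- The coefficients `v ↦ i eⱼ ⊗ v` of the operator `D = ∇⊗` on `ℂⁿ`-valued functions. The space
`ℂⁿ ⊗ ℂⁿ` is the Hermitian space of arrays `(w_{kl})`, and `(eⱼ ⊗ v)_{kl} = δ_{jk} v_l`. -/
def gradCoeff (n : ℕ) (j : Fin n) : CSpace (Fin n) →L[ℂ] CSpace (Fin n × Fin n) :=
  LinearMap.toContinuousLinearMap
    { toFun := fun v => WithLp.toLp 2 fun kl => if kl.1 = j then Complex.I * v kl.2 else 0
      map_add' := by
        intro v w
        ext kl
        by_cases h : kl.1 = j <;> simp [h, mul_add]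
      map_smul' := by
        intro a v
        ext kl
        by_cases h : kl.1 = j <;> simp [h, mul_left_comm] }

/-- The symmetrizer `(A w)_{kl} = w_{kl} + w_{lk}` on `ℂⁿ ⊗ ℂⁿ`. -/
def symmetrizer (n : ℕ) : CSpace (Fin n × Fin n) →L[ℂ] CSpace (Fin n × Fin n) :=
  LinearMap.toContinuousLinearMap
    { toFun := fun w => WithLp.toLp 2 fun kl => w (kl.1, kl.2) + w (kl.2, kl.1)
      map_add' := by
        intro v w
        ext kl
        simp [add_add_add_comm]
      map_smul' := by
        intro a v
        ext kl
        simp [mul_add] }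

end Coercivity

end

namespace Coercivity

/-- A smooth convex function of two variables, dominated by `|ζ|^p + |η|^q` up to the error `δ`,
whose Hessian controls the product of the two increments. -/
structure Bellman (p q C δ : ℝ) where
  B : ℝ → ℝ → ℝ
  B₁ : ℝ → ℝ → ℝ
  B₂ : ℝ → ℝ → ℝ
  B₁₁ : ℝ → ℝ → ℝ
  B₁₂ : ℝ → ℝ → ℝ
  B₂₂ : ℝ → ℝ → ℝ
  zero : B 0 0 = 0
  nonneg : ∀ ζ η, 0 ≤ B ζ η
  le : ∀ ζ η, B ζ η ≤ C * (|ζ| ^ p + |η| ^ q + δ)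
  cont : Continuous fun z : ℝ × ℝ => B z.1 z.2
  cont₁ : Continuous fun z : ℝ × ℝ => B₁ z.1 z.2
  cont₂ : Continuous fun z : ℝ × ℝ => B₂ z.1 z.2
  cont₁₁ : Continuous fun z : ℝ × ℝ => B₁₁ z.1 z.2
  cont₁₂ : Continuous fun z : ℝ × ℝ => B₁₂ z.1 z.2
  cont₂₂ : Continuous fun z : ℝ × ℝ => B₂₂ z.1 z.2
  deriv : ∀ {z h : ℝ → ℝ} {z' h' t : ℝ}, HasDerivAt z z' t → HasDerivAt h h' t →
    HasDerivAt (fun s => B (z s) (h s)) (B₁ (z t) (h t) * z' + B₂ (z t) (h t) * h') t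
  deriv₁ : ∀ {z h : ℝ → ℝ} {z' h' t : ℝ}, HasDerivAt z z' t → HasDerivAt h h' t →
    HasDerivAt (fun s => B₁ (z s) (h s)) (B₁₁ (z t) (h t) * z' + B₁₂ (z t) (h t) * h') t
  deriv₂ : ∀ {z h : ℝ → ℝ} {z' h' t : ℝ}, HasDerivAt z z' t → HasDerivAt h h' t →
    HasDerivAt (fun s => B₂ (z s) (h s)) (B₁₂ (z t) (h t) * z' + B₂₂ (z t) (h t) * h') t
  hess : ∀ ζ η, ∃ τ : ℝ, 0 < τ ∧ ∀ x y : ℝ,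
    τ * x ^ 2 + τ⁻¹ * y ^ 2 ≤ B₁₁ ζ η * x ^ 2 + 2 * B₁₂ ζ η * x * y + B₂₂ ζ η * y ^ 2

/-- Exchanging the two variables of a Bellman function. -/
def Bellman.swap {p q C δ : ℝ} (b : Bellman p q C δ) : Bellman q p C δ where
  B ζ η := b.B η ζ
  B₁ ζ η := b.B₂ η ζ
  B₂ ζ η := b.B₁ η ζ
  B₁₁ ζ η := b.B₂₂ η ζ
  B₁₂ ζ η := b.B₁₂ η ζ
  B₂₂ ζ η := b.B₁₁ η ζ
  zero := b.zero
  nonneg ζ η := b.nonneg η ζ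
  le ζ η := (b.le η ζ).trans_eq (by ring)
  cont := b.cont.comp continuous_swap
  cont₁ := b.cont₂.comp continuous_swap
  cont₂ := b.cont₁.comp continuous_swap
  cont₁₁ := b.cont₂₂.comp continuous_swap
  cont₁₂ := b.cont₁₂.comp continuous_swap
  cont₂₂ := b.cont₁₁.comp continuous_swap
  deriv hz hh := (b.deriv hh hz).congr_deriv (by ring)
  deriv₁ hz hh := (b.deriv₂ hh hz).congr_deriv (by ring)
  deriv₂ hz hh := (b.deriv₁ hh hz).congr_deriv (by ring)
  hess ζ η := by
    obtain ⟨τ, hτ, h⟩ := b.hess η ζ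
    refine ⟨τ⁻¹, inv_pos.2 hτ, fun x y => ?_⟩
    have := h y x
    rw [inv_inv]
    linarith

section Construction

variable (a b K e : ℝ)

/-- The sum `(ζ² + e)^a + (η² + e)^b`. -/
noncomputable def bellM (ζ η : ℝ) : ℝ := (ζ ^ 2 + e) ^ a + (η ^ 2 + e) ^ b

/-- The weight `((ζ² + e)^a + (η² + e)^b)^(1 - 1/a)`. -/
noncomputable def bellT (ζ η : ℝ) : ℝ := bellM a b e ζ η ^ ((a - 1) / a)

variable {a b K e}

lemma bellM_pos (he : 0 < e) (ζ η : ℝ) : 0 < bellM a b e ζ η := by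
  unfold bellM; positivity

lemma bellT_pos (he : 0 < e) (ζ η : ℝ) : 0 < bellT a b e ζ η :=
  Real.rpow_pos_of_pos (bellM_pos he ζ η) _

lemma hasDerivAt_sq_add_rpow (he : 0 < e) (c : ℝ) {z : ℝ → ℝ} {z' t : ℝ} (hz : HasDerivAt z z' t) :
    HasDerivAt (fun s => (z s ^ 2 + e) ^ c)
      (2 * z t * z' * c * ((z t ^ 2 + e) ^ c / (z t ^ 2 + e))) t := by
  have hX : 0 < z t ^ 2 + e := by positivity
  have h1 : HasDerivAt (fun s => z s ^ 2 + e) (2 * z t * z') t :=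
    ((hz.pow 2).add_const e).congr_deriv (by push_cast; ring)
  refine (h1.rpow_const (p := c) (Or.inl hX.ne')).congr_deriv ?_
  rw [Real.rpow_sub_one hX.ne']

lemma hasDerivAt_bellM (he : 0 < e) {z h : ℝ → ℝ} {z' h' t : ℝ} (hz : HasDerivAt z z' t)
    (hh : HasDerivAt h h' t) :
    HasDerivAt (fun s => bellM a b e (z s) (h s))
      (2 * z t * z' * a * ((z t ^ 2 + e) ^ a / (z t ^ 2 + e)) +
        2 * h t * h' * b * ((h t ^ 2 + e) ^ b / (h t ^ 2 + e))) t :=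
  (hasDerivAt_sq_add_rpow he a hz).add (hasDerivAt_sq_add_rpow he b hh)

lemma hasDerivAt_bellT (he : 0 < e) {z h : ℝ → ℝ} {z' h' t : ℝ} (hz : HasDerivAt z z' t)
    (hh : HasDerivAt h h' t) :
    HasDerivAt (fun s => bellT a b e (z s) (h s))
      ((2 * z t * z' * a * ((z t ^ 2 + e) ^ a / (z t ^ 2 + e)) +
        2 * h t * h' * b * ((h t ^ 2 + e) ^ b / (h t ^ 2 + e))) * ((a - 1) / a) *
          (bellT a b e (z t) (h t) / bellM a b e (z t) (h t))) t := by
  have hM := bellM_pos (a := a) (b := b) he (z t) (h t)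
  refine ((hasDerivAt_bellM he hz hh).rpow_const (p := (a - 1) / a)
    (Or.inl hM.ne')).congr_deriv ?_
  rw [Real.rpow_sub_one hM.ne']; rfl

lemma continuous_bellM (he : 0 < e) : Continuous fun z : ℝ × ℝ => bellM a b e z.1 z.2 := by
  unfold bellM
  refine (Continuous.rpow_const (by fun_prop) fun _ => Or.inl ?_).add
    (Continuous.rpow_const (by fun_prop) fun _ => Or.inl ?_) <;> positivity

lemma continuous_bellT (he : 0 < e) : Continuous fun z : ℝ × ℝ => bellT a b e z.1 z.2 :=
  (continuous_bellM he).rpow_const fun _ => Or.inl (bellM_pos he _ _).ne'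

lemma mul_bellT_le (ha : 1 ≤ a) (he : 0 < e) (ζ η : ℝ) :
    (ζ ^ 2 + e) * bellT a b e ζ η ≤ bellM a b e ζ η := by
  have hM := bellM_pos (a := a) (b := b) he ζ η
  have hX : 0 < ζ ^ 2 + e := by positivity
  have h1 : ζ ^ 2 + e ≤ bellM a b e ζ η ^ (1 / a) := by
    calc ζ ^ 2 + e = ((ζ ^ 2 + e) ^ a) ^ (1 / a) := by
          rw [← Real.rpow_mul hX.le, mul_one_div_cancel (by positivity), Real.rpow_one]
      _ ≤ _ := by
          refine Real.rpow_le_rpow (by positivity) ?_ (by positivity)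
          unfold bellM
          have : 0 ≤ (η ^ 2 + e) ^ b := by positivity
          linarith
  calc _ ≤ bellM a b e ζ η ^ (1 / a) * bellM a b e ζ η ^ ((a - 1) / a) :=
        mul_le_mul_of_nonneg_right h1 (bellT_pos he _ _).le
    _ = _ := by
        rw [← Real.rpow_add hM, ← add_div, add_sub_cancel, div_self (by positivity), Real.rpow_one]

lemma le_rpow_mul_bellT (ha : 1 ≤ a) (hb : 0 < b) (hab : 1 / a + 1 / b = 2) (he : 0 < e)
    (ζ η : ℝ) : η ^ 2 + e ≤ (η ^ 2 + e) ^ b * bellT a b e ζ η := by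
  have hY : 0 < η ^ 2 + e := by positivity
  have hα : (a - 1) / a = 1 / b - 1 := by
    rw [sub_div, div_self (by positivity)]; linarith
  have h1 : ((η ^ 2 + e) ^ b) ^ ((a - 1) / a) ≤ bellT a b e ζ η := by
    refine Real.rpow_le_rpow (by positivity) ?_ (div_nonneg (by linarith) (by linarith))
    unfold bellM
    have : 0 ≤ (ζ ^ 2 + e) ^ a := by positivity
    linarith
  calc η ^ 2 + e = (η ^ 2 + e) ^ b * ((η ^ 2 + e) ^ b) ^ ((a - 1) / a) := by
        rw [← Real.rpow_mul hY.le, ← Real.rpow_add hY, hα]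
        have : b + b * (1 / b - 1) = 1 := by field_simp; ring
        rw [this, Real.rpow_one]
    _ ≤ _ := by gcongr

lemma cross_le (ha : 1 ≤ a) (hb : 0 < b) (hab : 1 / a + 1 / b = 2) (he : 0 < e) (ζ η : ℝ) :
    |ζ * η| * (((η ^ 2 + e) ^ b) ^ 2 / (η ^ 2 + e)) *
      (bellT a b e ζ η / bellM a b e ζ η ^ 2) ≤ 1 := by
  have hY : 0 < η ^ 2 + e := by positivity
  have hX : 0 < ζ ^ 2 + e := by positivity
  have hQ : 0 < (η ^ 2 + e) ^ b := by positivity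
  have hP : 0 < (ζ ^ 2 + e) ^ a := by positivity
  have hM := bellM_pos (a := a) (b := b) he ζ η
  have hT := bellT_pos (a := a) (b := b) he ζ η
  have hQM : (η ^ 2 + e) ^ b ≤ bellM a b e ζ η := by unfold bellM; linarith
  have hXT := mul_bellT_le (b := b) ha he ζ η
  have hα : (a - 1) / a = 1 / b - 1 := by
    rw [sub_div, div_self (by positivity)]; linarith
  have hα1 : (a - 1) / a ≤ 1 := by rw [div_le_one (by positivity)]; linarith
  -- the quantity `Q T` is at most `Q^α M`
  have key : ((η ^ 2 + e) ^ b) ^ 2 * bellT a b e ζ η ≤ (η ^ 2 + e) * bellM a b e ζ η := by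
    have e1 : (η ^ 2 + e) = (η ^ 2 + e) ^ b * ((η ^ 2 + e) ^ b) ^ ((a - 1) / a) := by
      rw [← Real.rpow_mul hY.le, ← Real.rpow_add hY, hα]
      have : b + b * (1 / b - 1) = 1 := by field_simp; ring
      rw [this, Real.rpow_one]
    set Q := (η ^ 2 + e) ^ b
    set M := bellM a b e ζ η
    have hTM : bellT a b e ζ η = M ^ ((a - 1) / a) := rfl
    have h2 : Q ^ (1 - (a - 1) / a) ≤ M ^ (1 - (a - 1) / a) :=
      Real.rpow_le_rpow hQ.le hQM (by linarith)
    have h3 : Q = Q ^ (1 - (a - 1) / a) * Q ^ ((a - 1) / a) := by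
      rw [← Real.rpow_add hQ]; simp
    have h4 : M = M ^ (1 - (a - 1) / a) * M ^ ((a - 1) / a) := by
      rw [← Real.rpow_add hM]; simp
    calc Q ^ 2 * bellT a b e ζ η = Q * (Q * M ^ ((a - 1) / a)) := by rw [hTM]; ring
      _ = Q * (Q ^ (1 - (a - 1) / a) * Q ^ ((a - 1) / a) * M ^ ((a - 1) / a)) := by rw [← h3]
      _ ≤ Q * (M ^ (1 - (a - 1) / a) * Q ^ ((a - 1) / a) * M ^ ((a - 1) / a)) := by gcongr
      _ = Q * Q ^ ((a - 1) / a) * (M ^ (1 - (a - 1) / a) * M ^ ((a - 1) / a)) := by ring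
      _ = (η ^ 2 + e) * M := by rw [← h4, ← e1]
  set Q := (η ^ 2 + e) ^ b
  set M := bellM a b e ζ η
  set T := bellT a b e ζ η
  set X := ζ ^ 2 + e with hXdef
  set Y := η ^ 2 + e with hYdef
  rw [show |ζ * η| * (Q ^ 2 / Y) * (T / M ^ 2) = (|ζ * η| * Q ^ 2 * T) / (Y * M ^ 2) by
    field_simp, div_le_one (by positivity)]
  refine le_of_sq_le_sq ?_ (by positivity)
  have h5 : |ζ * η| ^ 2 ≤ X * Y := by
    rw [sq_abs, mul_pow]
    exact mul_le_mul (by linarith) (by linarith) (by positivity) hX.le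
  calc (|ζ * η| * Q ^ 2 * T) ^ 2 = |ζ * η| ^ 2 * (Q ^ 2 * T) * Q ^ 2 * T := by ring
    _ ≤ (X * Y) * (Y * M) * M ^ 2 * T := by gcongr
    _ = (X * T) * (Y ^ 2 * M ^ 3) := by ring
    _ ≤ M * (Y ^ 2 * M ^ 3) := by gcongr
    _ = (Y * M ^ 2) ^ 2 := by ring

end Construction

section Construction

variable (a b K e : ℝ)

/-- The function `X M^(1 - 1/a) + K Y^b`, with `X = ζ² + e`, `Y = η² + e`, `M = X^a + Y^b`. -/
noncomputable def bell (ζ η : ℝ) : ℝ := (ζ ^ 2 + e) * bellT a b e ζ η + K * (η ^ 2 + e) ^ b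

/-- The first partial derivative of `bell`. -/
noncomputable def bell₁ (ζ η : ℝ) : ℝ :=
  2 * ζ * (bellT a b e ζ η * (1 + (a - 1) * ((ζ ^ 2 + e) ^ a / bellM a b e ζ η)))

/-- The second partial derivative of `bell`. -/
noncomputable def bell₂ (ζ η : ℝ) : ℝ :=
  2 * η * b * ((η ^ 2 + e) ^ b / (η ^ 2 + e)) *
    ((a - 1) / a * ((ζ ^ 2 + e) * bellT a b e ζ η / bellM a b e ζ η) + K)

/-- The second derivative of `bell` in the first variable. -/
noncomputable def bell₁₁ (ζ η : ℝ) : ℝ :=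
  2 * (bellT a b e ζ η * (1 + (a - 1) * ((ζ ^ 2 + e) ^ a / bellM a b e ζ η))) +
    4 * ζ ^ 2 * (a - 1) * ((ζ ^ 2 + e) ^ a / (ζ ^ 2 + e)) *
      (bellT a b e ζ η / bellM a b e ζ η) * (1 + a - (ζ ^ 2 + e) ^ a / bellM a b e ζ η)

/-- The mixed second derivative of `bell`. -/
noncomputable def bell₁₂ (ζ η : ℝ) : ℝ :=
  4 * ζ * η * ((a - 1) / a) * b * (((η ^ 2 + e) ^ b) ^ 2 / (η ^ 2 + e)) *
    (bellT a b e ζ η / bellM a b e ζ η ^ 2)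

/-- The second derivative of `bell` in the second variable. -/
noncomputable def bell₂₂ (ζ η : ℝ) : ℝ :=
  (η ^ 2 + e) ^ b / (η ^ 2 + e) *
    (2 * b * ((a - 1) / a * ((ζ ^ 2 + e) * bellT a b e ζ η / bellM a b e ζ η) + K) *
        (1 - 2 * (1 - b) * (η ^ 2 / (η ^ 2 + e))) -
      4 * b ^ 2 * ((a - 1) / a) * (1 / a) * (η ^ 2 / (η ^ 2 + e)) *
        ((η ^ 2 + e) ^ b / bellM a b e ζ η) *
          ((ζ ^ 2 + e) * bellT a b e ζ η / bellM a b e ζ η))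

variable {a b K e}

lemma hasDerivAt_bell (ha : 1 ≤ a) (he : 0 < e) {z h : ℝ → ℝ} {z' h' t : ℝ}
    (hz : HasDerivAt z z' t) (hh : HasDerivAt h h' t) :
    HasDerivAt (fun s => bell a b K e (z s) (h s))
      (bell₁ a b e (z t) (h t) * z' + bell₂ a b K e (z t) (h t) * h') t := by
  have hX : 0 < z t ^ 2 + e := by positivity
  have hY : 0 < h t ^ 2 + e := by positivity
  have hM := bellM_pos (a := a) (b := b) he (z t) (h t)
  have h1 : HasDerivAt (fun s => z s ^ 2 + e) (2 * z t * z') t :=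
    ((hz.pow 2).add_const e).congr_deriv (by push_cast; ring)
  refine ((h1.mul (hasDerivAt_bellT (a := a) (b := b) he hz hh)).add
    ((hasDerivAt_sq_add_rpow he b hh).const_mul K)).congr_deriv ?_
  unfold bell₁ bell₂
  have : a ≠ 0 := by positivity
  field_simp
  ring

lemma hasDerivAt_bell₁ (ha : 1 ≤ a) (he : 0 < e) {z h : ℝ → ℝ} {z' h' t : ℝ}
    (hz : HasDerivAt z z' t) (hh : HasDerivAt h h' t) :
    HasDerivAt (fun s => bell₁ a b e (z s) (h s))
      (bell₁₁ a b e (z t) (h t) * z' + bell₁₂ a b e (z t) (h t) * h') t := by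
  have hX : 0 < z t ^ 2 + e := by positivity
  have hY : 0 < h t ^ 2 + e := by positivity
  have hM := bellM_pos (a := a) (b := b) he (z t) (h t)
  refine ((hz.const_mul 2).mul ((hasDerivAt_bellT (a := a) (b := b) he hz hh).mul
    ((((hasDerivAt_sq_add_rpow he a hz).div (hasDerivAt_bellM (a := a) (b := b) he hz hh)
      hM.ne').const_mul (a - 1)).const_add 1))).congr_deriv ?_
  have e1 : (h t ^ 2 + e) ^ b = bellM a b e (z t) (h t) - (z t ^ 2 + e) ^ a := by
    unfold bellM; ring
  unfold bell₁₁ bell₁₂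
  simp only [Pi.mul_apply, Pi.div_apply, e1]
  have : a ≠ 0 := by positivity
  field_simp
  ring

lemma hasDerivAt_bell₂ (ha : 1 ≤ a) (he : 0 < e) {z h : ℝ → ℝ} {z' h' t : ℝ}
    (hz : HasDerivAt z z' t) (hh : HasDerivAt h h' t) :
    HasDerivAt (fun s => bell₂ a b K e (z s) (h s))
      (bell₁₂ a b e (z t) (h t) * z' + bell₂₂ a b K e (z t) (h t) * h') t := by
  have hX : 0 < z t ^ 2 + e := by positivity
  have hY : 0 < h t ^ 2 + e := by positivity
  have hM := bellM_pos (a := a) (b := b) he (z t) (h t)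
  have h1 : HasDerivAt (fun s => z s ^ 2 + e) (2 * z t * z') t :=
    ((hz.pow 2).add_const e).congr_deriv (by push_cast; ring)
  have h2 : HasDerivAt (fun s => h s ^ 2 + e) (2 * h t * h') t :=
    ((hh.pow 2).add_const e).congr_deriv (by push_cast; ring)
  refine ((((hh.const_mul 2).mul_const b).mul ((hasDerivAt_sq_add_rpow he b hh).div h2
    hY.ne')).mul ((((h1.mul (hasDerivAt_bellT (a := a) (b := b) he hz hh)).div
      (hasDerivAt_bellM (a := a) (b := b) he hz hh) hM.ne').const_mul
        ((a - 1) / a)).add_const K)).congr_deriv ?_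
  have e1 : (z t ^ 2 + e) ^ a = bellM a b e (z t) (h t) - (h t ^ 2 + e) ^ b := by
    unfold bellM; ring
  unfold bell₂₂ bell₁₂
  simp only [Pi.mul_apply, Pi.div_apply, e1]
  have : a ≠ 0 := by positivity
  field_simp
  ring

lemma two_mul_le_bell₁₁ (ha : 1 ≤ a) (he : 0 < e) (ζ η : ℝ) :
    2 * bellT a b e ζ η ≤ bell₁₁ a b e ζ η := by
  have hX : 0 < ζ ^ 2 + e := by positivity
  have hY : 0 < η ^ 2 + e := by positivity
  have hM := bellM_pos (a := a) (b := b) he ζ η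
  have hT := bellT_pos (a := a) (b := b) he ζ η
  have hP : 0 < (ζ ^ 2 + e) ^ a := by positivity
  have hPM : (ζ ^ 2 + e) ^ a / bellM a b e ζ η ≤ 1 := by
    rw [div_le_one hM]; unfold bellM
    have : 0 ≤ (η ^ 2 + e) ^ b := by positivity
    linarith
  have h1 : 0 ≤ 1 + a - (ζ ^ 2 + e) ^ a / bellM a b e ζ η := by linarith
  have ha' : 0 ≤ a - 1 := by linarith
  have h2 : 0 ≤ bellT a b e ζ η * ((a - 1) * ((ζ ^ 2 + e) ^ a / bellM a b e ζ η)) := by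
    positivity
  have h3 : 0 ≤ 4 * ζ ^ 2 * (a - 1) * ((ζ ^ 2 + e) ^ a / (ζ ^ 2 + e)) *
      (bellT a b e ζ η / bellM a b e ζ η) * (1 + a - (ζ ^ 2 + e) ^ a / bellM a b e ζ η) := by
    positivity
  unfold bell₁₁
  linarith

lemma abs_bell₁₂_le (ha : 1 ≤ a) (hb : 0 < b) (hb1 : b ≤ 1) (hab : 1 / a + 1 / b = 2)
    (he : 0 < e) (ζ η : ℝ) : |bell₁₂ a b e ζ η| ≤ 4 := by
  have hY : 0 < η ^ 2 + e := by positivity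
  have hM := bellM_pos (a := a) (b := b) he ζ η
  have hT := bellT_pos (a := a) (b := b) he ζ η
  have hα : (a - 1) / a ≤ 1 := by rw [div_le_one (by positivity)]; linarith
  have hα0 : 0 ≤ (a - 1) / a := div_nonneg (by linarith) (by linarith)
  have key := cross_le (a := a) ha hb hab he ζ η
  set W := |ζ * η| * (((η ^ 2 + e) ^ b) ^ 2 / (η ^ 2 + e)) *
      (bellT a b e ζ η / bellM a b e ζ η ^ 2) with hW
  have hW0 : 0 ≤ W := by positivity
  have : |bell₁₂ a b e ζ η| = 4 * ((a - 1) / a * b * W) := by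
    rw [bell₁₂, show 4 * ζ * η * ((a - 1) / a) * b * (((η ^ 2 + e) ^ b) ^ 2 / (η ^ 2 + e)) *
      (bellT a b e ζ η / bellM a b e ζ η ^ 2) = (ζ * η) * (4 * ((a - 1) / a) * b *
        (((η ^ 2 + e) ^ b) ^ 2 / (η ^ 2 + e)) * (bellT a b e ζ η / bellM a b e ζ η ^ 2)) by ring,
      abs_mul, abs_of_nonneg (a := 4 * _ * _ * _ * _) (by positivity), hW]
    ring
  rw [this]
  have : (a - 1) / a * b * W ≤ 1 := by
    calc (a - 1) / a * b * W ≤ 1 * 1 * 1 := by gcongr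
      _ = 1 := by norm_num
  linarith

lemma div_bellT_le_bell₂₂ (ha : 1 ≤ a) (hb : 1 / 2 < b) (hb1 : b ≤ 1)
    (hab : 1 / a + 1 / b = 2) (hK : K = 10 / (b * (2 * b - 1))) (he : 0 < e) (ζ η : ℝ) :
    18 * (bellT a b e ζ η)⁻¹ ≤ bell₂₂ a b K e ζ η := by
  have hX : 0 < ζ ^ 2 + e := by positivity
  have hY : 0 < η ^ 2 + e := by positivity
  have hQ : 0 < (η ^ 2 + e) ^ b := by positivity
  have hP : 0 < (ζ ^ 2 + e) ^ a := by positivity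
  have hM := bellM_pos (a := a) (b := b) he ζ η
  have hT := bellT_pos (a := a) (b := b) he ζ η
  have hα : (a - 1) / a ≤ 1 := by rw [div_le_one (by positivity)]; linarith
  have hα0 : 0 ≤ (a - 1) / a := div_nonneg (by linarith) (by linarith)
  have hα' : 1 / a = 1 - (a - 1) / a := by field_simp; ring
  have hαb : (a - 1) / a = 1 / b - 1 := by rw [eq_sub_iff_add_eq, ← sub_eq_zero]; linarith
  have hbα : b * ((a - 1) / a) = 1 - b := by rw [hαb]; field_simp
  have hb2 : 0 < 2 * b - 1 := by linarith
  have hKb : b * K * (2 * b - 1) = 10 := by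
    have hbb : b * (2 * b - 1) ≠ 0 := by positivity
    rw [hK, mul_right_comm, mul_div_cancel₀ _ hbb]
  have hK0 : 0 < K := by rw [hK]; positivity
  have hQM : (η ^ 2 + e) ^ b / bellM a b e ζ η ≤ 1 := by
    rw [div_le_one hM]; unfold bellM; linarith
  have hθ : (ζ ^ 2 + e) * bellT a b e ζ η / bellM a b e ζ η ≤ 1 := by
    rw [div_le_one hM]; exact mul_bellT_le ha he ζ η
  have hρ : η ^ 2 / (η ^ 2 + e) ≤ 1 := by rw [div_le_one hY]; linarith
  have h1 : (bellT a b e ζ η)⁻¹ ≤ (η ^ 2 + e) ^ b / (η ^ 2 + e) := by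
    rw [inv_eq_one_div, div_le_div_iff₀ hT hY, one_mul]
    exact le_rpow_mul_bellT ha (by linarith) hab he ζ η
  have h2 : 0 ≤ (ζ ^ 2 + e) * bellT a b e ζ η / bellM a b e ζ η := by positivity
  have h3 : 0 ≤ η ^ 2 / (η ^ 2 + e) := by positivity
  have h4 : 0 ≤ (η ^ 2 + e) ^ b / bellM a b e ζ η := by positivity
  rw [mul_comm]
  unfold bell₂₂
  rw [hα']
  generalize (a - 1) / a = α at *
  generalize (ζ ^ 2 + e) * bellT a b e ζ η / bellM a b e ζ η = θ at *
  generalize η ^ 2 / (η ^ 2 + e) = ρ at *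
  generalize (η ^ 2 + e) ^ b / bellM a b e ζ η = κ at *
  refine mul_le_mul h1 ?_ (by norm_num) (by positivity)
  have hbb : 0 ≤ 1 - b := by linarith
  have h5 : 2 * b - 1 ≤ 1 - 2 * (1 - b) * ρ := by nlinarith
  have h6 : 20 ≤ 2 * b * K * (1 - 2 * (1 - b) * ρ) := by
    calc (20 : ℝ) = 2 * (b * K * (2 * b - 1)) := by rw [hKb]; norm_num
      _ = 2 * b * K * (2 * b - 1) := by ring
      _ ≤ _ := by gcongr
  have hb0 : 0 ≤ b := by linarith
  have hα1 : 0 ≤ 1 - α := by linarith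
  have h7 : 0 ≤ 2 * b * (α * θ) * (1 - 2 * (1 - b) * ρ) :=
    mul_nonneg (by positivity) (by linarith)
  have h8 : 4 * b ^ 2 * α * (1 - α) * ρ * κ * θ ≤ 2 := by
    have : b ^ 2 * α * (1 - α) = (1 - b) * (2 * b - 1) := by
      calc b ^ 2 * α * (1 - α) = (b * α) * (b - b * α) := by ring
        _ = _ := by rw [hbα]; ring
    calc 4 * b ^ 2 * α * (1 - α) * ρ * κ * θ
        = (4 * (b ^ 2 * α * (1 - α))) * ρ * κ * θ := by ring
      _ ≤ (4 * (b ^ 2 * α * (1 - α))) * 1 * 1 * 1 := by gcongr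
      _ ≤ 2 := by rw [this]; nlinarith [sq_nonneg (4 * b - 3)]
  nlinarith

/-- The Bellman function for exponents `p ≥ 2 ≥ q`. -/
theorem exists_bellman_of_two_le {p q : ℝ} (hp : 2 ≤ p) (hpq : p.HolderConjugate q) :
    ∃ C : ℝ, 0 < C ∧ ∀ δ : ℝ, 0 < δ → Nonempty (Bellman p q C δ) := by
  have hp0 : 0 < p := by linarith
  have hq0 : 0 < q := hpq.symm.pos
  have hq1 : 1 < q := hpq.symm.lt
  have hinv := hpq.inv_add_inv_eq_one
  have ha : 1 ≤ p / 2 := by linarith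
  have hb : 1 / 2 < q / 2 := by linarith
  have hq2 : q ≤ 2 := by
    have h1 : p⁻¹ ≤ 2⁻¹ := inv_anti₀ (by norm_num) hp
    have h2 : (2 : ℝ)⁻¹ ≤ q⁻¹ := by norm_num at *; linarith
    exact (inv_le_inv₀ (by norm_num) hq0).1 h2
  have hb1 : q / 2 ≤ 1 := by linarith
  have hab : 1 / (p / 2) + 1 / (q / 2) = 2 := by
    rw [one_div_div, one_div_div, div_eq_mul_inv, div_eq_mul_inv]; linarith
  set a := p / 2 with ha_def
  set b := q / 2 with hb_def
  have hb0 : 0 < b := by linarith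
  have hb2 : 0 < 2 * b - 1 := by linarith
  set K := 10 / (b * (2 * b - 1)) with hK
  have hK0 : 0 < K := by positivity
  refine ⟨(1 + K) * 2 ^ a, by positivity, fun δ hδ => ?_⟩
  obtain ⟨e, he, heδ⟩ : ∃ e : ℝ, 0 < e ∧ e ^ a + e ^ b < δ := by
    have hc : Continuous fun e : ℝ => e ^ a + e ^ b :=
      (continuous_id.rpow_const fun _ => Or.inr (by linarith)).add
        (continuous_id.rpow_const fun _ => Or.inr hb0.le)
    have h0 : (fun e : ℝ => e ^ a + e ^ b) 0 < δ := by
      simp [Real.zero_rpow hb0.ne', Real.zero_rpow (show a ≠ 0 by linarith), hδ]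
    have := (hc.tendsto 0).eventually (gt_mem_nhds h0)
    obtain ⟨e, h1, h2⟩ := ((this.filter_mono nhdsWithin_le_nhds).and
      (self_mem_nhdsWithin (s := Set.Ioi (0 : ℝ)))).exists
    exact ⟨e, h2, h1⟩
  have hMc := continuous_bellM (a := a) (b := b) he
  have hTc := continuous_bellT (a := a) (b := b) he
  have hXc : ∀ c : ℝ, Continuous fun z : ℝ × ℝ => (z.1 ^ 2 + e) ^ c := fun c =>
    Continuous.rpow_const (by fun_prop) fun z => Or.inl (by positivity)
  have hYc : ∀ c : ℝ, Continuous fun z : ℝ × ℝ => (z.2 ^ 2 + e) ^ c := fun c =>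
    Continuous.rpow_const (by fun_prop) fun z => Or.inl (by positivity)
  have hM0 : ∀ z : ℝ × ℝ, bellM a b e z.1 z.2 ≠ 0 := fun z => (bellM_pos he _ _).ne'
  have hX0 : ∀ z : ℝ × ℝ, z.1 ^ 2 + e ≠ 0 := fun z => by positivity
  have hY0 : ∀ z : ℝ × ℝ, z.2 ^ 2 + e ≠ 0 := fun z => by positivity
  have hPc := hXc a
  have hQc := hYc b
  have hT1 : Continuous fun z : ℝ × ℝ => bellT a b e z.1 z.2 / bellM a b e z.1 z.2 ^ 2 :=
    hTc.div (hMc.pow 2) fun z => pow_ne_zero 2 (hM0 z)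
  have hT2 : Continuous fun z : ℝ × ℝ => bellT a b e z.1 z.2 / bellM a b e z.1 z.2 :=
    hTc.div hMc hM0
  have hPM : Continuous fun z : ℝ × ℝ => (z.1 ^ 2 + e) ^ a / bellM a b e z.1 z.2 :=
    hPc.div hMc hM0
  have hQM : Continuous fun z : ℝ × ℝ => (z.2 ^ 2 + e) ^ b / bellM a b e z.1 z.2 :=
    hQc.div hMc hM0
  have hPX : Continuous fun z : ℝ × ℝ => (z.1 ^ 2 + e) ^ a / (z.1 ^ 2 + e) :=
    hPc.div (by fun_prop) hX0
  have hQY : Continuous fun z : ℝ × ℝ => (z.2 ^ 2 + e) ^ b / (z.2 ^ 2 + e) :=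
    hQc.div (by fun_prop) hY0
  have hQQY : Continuous fun z : ℝ × ℝ => ((z.2 ^ 2 + e) ^ b) ^ 2 / (z.2 ^ 2 + e) :=
    (hQc.pow 2).div (by fun_prop) hY0
  have hyY : Continuous fun z : ℝ × ℝ => z.2 ^ 2 / (z.2 ^ 2 + e) :=
    Continuous.div (by fun_prop) (by fun_prop) hY0
  have hXTM : Continuous fun z : ℝ × ℝ =>
      (z.1 ^ 2 + e) * bellT a b e z.1 z.2 / bellM a b e z.1 z.2 :=
    Continuous.div (by fun_prop) hMc hM0
  have hmono : ∀ ζ η, bell a b K e 0 0 ≤ bell a b K e ζ η := by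
    intro ζ η
    have h1 : (0 : ℝ) ^ 2 + e ≤ ζ ^ 2 + e := by nlinarith [sq_nonneg ζ]
    have h2 : (0 : ℝ) ^ 2 + e ≤ η ^ 2 + e := by nlinarith [sq_nonneg η]
    have h3 : (0 : ℝ) < 0 ^ 2 + e := by positivity
    have h4 : bellM a b e 0 0 ≤ bellM a b e ζ η := by
      unfold bellM
      exact add_le_add (Real.rpow_le_rpow h3.le h1 (by linarith))
        (Real.rpow_le_rpow h3.le h2 hb0.le)
    have h5 : bellT a b e 0 0 ≤ bellT a b e ζ η :=
      Real.rpow_le_rpow (bellM_pos he _ _).le h4 (div_nonneg (by linarith) (by linarith))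
    unfold bell
    exact add_le_add (mul_le_mul h1 h5 (bellT_pos he _ _).le (by positivity))
      (mul_le_mul_of_nonneg_left (Real.rpow_le_rpow h3.le h2 hb0.le) hK0.le)
  have hsum : ∀ c : ℝ, 0 < c → c ≤ a → ∀ z : ℝ,
      (z ^ 2 + e) ^ c ≤ 2 ^ a * (|z| ^ (2 * c) + e ^ c) := by
    intro c hc hca z
    have h1 : (z ^ 2 + e) ^ c ≤ (2 * max (z ^ 2) e) ^ c :=
      Real.rpow_le_rpow (by positivity)
        (by linarith [le_max_left (z ^ 2) e, le_max_right (z ^ 2) e]) hc.le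
    have h2 : (max (z ^ 2) e) ^ c ≤ |z| ^ (2 * c) + e ^ c := by
      have : (z ^ 2) ^ c = |z| ^ (2 * c) := by
        rw [← sq_abs, Real.rpow_mul (abs_nonneg z), Real.rpow_two]
      rcases max_cases (z ^ 2) e with h | h
      · rw [h.1, this]; have : 0 ≤ e ^ c := by positivity
        linarith
      · rw [h.1]; have : 0 ≤ |z| ^ (2 * c) := by positivity
        linarith
    calc _ ≤ _ := h1
      _ = 2 ^ c * (max (z ^ 2) e) ^ c := Real.mul_rpow (by norm_num) (by positivity)
      _ ≤ _ := by
        refine mul_le_mul (Real.rpow_le_rpow_of_exponent_le (by norm_num) hca) h2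
          (by positivity) (by positivity)
  exact ⟨{
    B := fun ζ η => bell a b K e ζ η - bell a b K e 0 0
    B₁ := bell₁ a b e
    B₂ := bell₂ a b K e
    B₁₁ := bell₁₁ a b e
    B₁₂ := bell₁₂ a b e
    B₂₂ := bell₂₂ a b K e
    zero := sub_self _
    nonneg := fun ζ η => sub_nonneg.2 (hmono ζ η)
    le := fun ζ η => by
      have h0 : 0 ≤ bell a b K e 0 0 := by
        unfold bell
        have := bellT_pos (a := a) (b := b) he 0 0
        positivity
      have h1 := mul_bellT_le (b := b) ha he ζ η
      have h2 := hsum a (by linarith) le_rfl ζ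
      have h3 := hsum b hb0 (by linarith) η
      rw [show 2 * a = p by rw [ha_def]; ring] at h2
      rw [show 2 * b = q by rw [hb_def]; ring] at h3
      have hP : 0 < (ζ ^ 2 + e) ^ a := by positivity
      have h4 : bell a b K e ζ η ≤ (1 + K) * ((ζ ^ 2 + e) ^ a + (η ^ 2 + e) ^ b) := by
        unfold bell
        unfold bellM at h1
        nlinarith
      have h5 : (ζ ^ 2 + e) ^ a + (η ^ 2 + e) ^ b ≤ 2 ^ a * (|ζ| ^ p + |η| ^ q + δ) := by
        have : 2 ^ a * (e ^ a + e ^ b) ≤ 2 ^ a * δ := by gcongr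
        linarith
      calc _ ≤ bell a b K e ζ η := by linarith
        _ ≤ _ := h4
        _ ≤ (1 + K) * (2 ^ a * (|ζ| ^ p + |η| ^ q + δ)) := by gcongr
        _ = _ := by ring
    cont := by unfold bell; fun_prop
    cont₁ := by unfold bell₁; fun_prop
    cont₂ := by unfold bell₂; fun_prop
    cont₁₁ := by unfold bell₁₁; fun_prop
    cont₁₂ := by unfold bell₁₂; fun_prop
    cont₂₂ := by unfold bell₂₂; fun_prop
    deriv := fun hz hh => (hasDerivAt_bell ha he hz hh).sub_const _
    deriv₁ := fun hz hh => hasDerivAt_bell₁ ha he hz hh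
    deriv₂ := fun hz hh => hasDerivAt_bell₂ ha he hz hh
    hess := fun ζ η => by
      have hT := bellT_pos (a := a) (b := b) he ζ η
      refine ⟨bellT a b e ζ η, hT, fun x y => ?_⟩
      have h1 := two_mul_le_bell₁₁ (b := b) ha he ζ η
      have h2 := abs_le.1 (abs_bell₁₂_le ha hb0 hb1 hab he ζ η)
      have h3 := div_bellT_le_bell₂₂ ha hb hb1 hab hK he ζ η
      set T := bellT a b e ζ η
      have h4 : 2 * T * x ^ 2 ≤ bell₁₁ a b e ζ η * x ^ 2 := by gcongr
      have h5 : 18 * T⁻¹ * y ^ 2 ≤ bell₂₂ a b K e ζ η * y ^ 2 := by gcongr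
      have h6 : -(4 * |x * y|) ≤ bell₁₂ a b e ζ η * (x * y) := by
        have := neg_abs_le (bell₁₂ a b e ζ η * (x * y))
        rw [abs_mul] at this
        have h7 : |bell₁₂ a b e ζ η| * |x * y| ≤ 4 * |x * y| :=
          mul_le_mul_of_nonneg_right (abs_bell₁₂_le ha hb0 hb1 hab he ζ η) (abs_nonneg _)
        linarith
      have h8 : 8 * |x * y| ≤ T * x ^ 2 + 16 * T⁻¹ * y ^ 2 := by
        have : 0 ≤ T * (|x| - 4 * T⁻¹ * |y|) ^ 2 := by positivity
        have h9 : T * (|x| - 4 * T⁻¹ * |y|) ^ 2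
            = T * x ^ 2 + 16 * T⁻¹ * y ^ 2 - 8 * |x * y| := by
          rw [abs_mul, ← sq_abs x, ← sq_abs y]; field_simp; ring
        linarith
      have h10 : 0 ≤ T⁻¹ * y ^ 2 := by positivity
      linarith }⟩

/-- Bellman functions exist for every pair of conjugate exponents. -/
theorem exists_bellman {p q : ℝ} (hpq : p.HolderConjugate q) :
    ∃ C : ℝ, 0 < C ∧ ∀ δ : ℝ, 0 < δ → Nonempty (Bellman p q C δ) := by
  rcases le_total 2 p with hp | hp
  · exact exists_bellman_of_two_le hp hpq
  · have hq : 2 ≤ q := by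
      have h1 : (2 : ℝ)⁻¹ ≤ p⁻¹ := inv_anti₀ hpq.pos hp
      have h2 : q⁻¹ ≤ 2⁻¹ := by
        have := hpq.inv_add_inv_eq_one
        norm_num at *; linarith
      exact (inv_le_inv₀ hpq.symm.pos (by norm_num)).1 h2
    obtain ⟨C, hC, h⟩ := exists_bellman_of_two_le hq hpq.symm
    exact ⟨C, hC, fun δ hδ => (h δ hδ).map Bellman.swap⟩

end Construction

section TestFunctions

variable {n : ℕ} {E F : Type} [NormedAddCommGroup E] [NormedSpace ℝ E]
  [NormedAddCommGroup F] [NormedSpace ℝ F]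

lemma IsTestFunction.continuous {f : RSpace n → F} (hf : IsTestFunction f) : Continuous f :=
  hf.smooth.continuous

lemma IsTestFunction.differentiable {f : RSpace n → F} (hf : IsTestFunction f) :
    Differentiable ℝ f :=
  hf.smooth.differentiable (by simp)

lemma IsTestFunction.clm_comp {f : RSpace n → E} (hf : IsTestFunction f) (L : E →L[ℝ] F) :
    IsTestFunction fun x => L (f x) :=
  ⟨L.contDiff.comp hf.smooth, hf.compactSupport.comp_left L.map_zero⟩

lemma IsTestFunction.fderiv {f : RSpace n → F} (hf : IsTestFunction f) :
    IsTestFunction (fderiv ℝ f) :=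
  ⟨hf.smooth.fderiv_right (m := ∞) (by simp), hf.compactSupport.fderiv ℝ⟩

lemma IsTestFunction.pderiv {f : RSpace n → F} (hf : IsTestFunction f) (i : Fin n) :
    IsTestFunction (pderiv i f) :=
  hf.fderiv.clm_comp (ContinuousLinearMap.apply ℝ F (EuclideanSpace.single i (1 : ℝ)))

lemma IsTestFunction.add {f g : RSpace n → F} (hf : IsTestFunction f) (hg : IsTestFunction g) :
    IsTestFunction fun x => f x + g x :=
  ⟨hf.smooth.add hg.smooth, hf.compactSupport.add hg.compactSupport⟩

lemma IsTestFunction.const_mul {f : RSpace n → ℝ} (hf : IsTestFunction f) (c : ℝ) :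
    IsTestFunction fun x => c * f x :=
  ⟨contDiff_const.mul hf.smooth, hf.compactSupport.mul_left⟩

lemma IsTestFunction.sum {ι : Type} {s : Finset ι} {f : ι → RSpace n → F}
    (hf : ∀ i ∈ s, IsTestFunction (f i)) : IsTestFunction fun x => ∑ i ∈ s, f i x := by
  classical
  induction s using Finset.induction_on with
  | empty => simpa using ⟨contDiff_const, HasCompactSupport.zero⟩
  | insert a s ha ih =>
    simp only [Finset.sum_insert ha]
    exact (hf a (Finset.mem_insert_self a s)).add
      (ih fun i hi => hf i (Finset.mem_insert_of_mem hi))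

lemma IsTestFunction.exists_bound {f : RSpace n → F} (hf : IsTestFunction f) :
    ∃ C : ℝ, 0 ≤ C ∧ ∀ x, ‖f x‖ ≤ C := by
  obtain ⟨C, hC⟩ := hf.compactSupport.exists_bound_of_continuous hf.continuous
  exact ⟨C, (norm_nonneg _).trans (hC 0), hC⟩

lemma IsTestFunction.exists_decay {f : RSpace n → ℝ} (hf : IsTestFunction f) (N : ℕ) :
    ∃ C : ℝ, 0 ≤ C ∧ ∀ x, |f x| * (1 + ‖x‖) ^ N ≤ C := by
  have hc : Continuous fun x => f x * (1 + ‖x‖) ^ N :=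
    hf.continuous.mul (by fun_prop)
  obtain ⟨C, hC⟩ := (hf.compactSupport.mul_right (f' := fun x => (1 + ‖x‖) ^ N)
    ).exists_bound_of_continuous hc
  refine ⟨C, (norm_nonneg _).trans (hC 0), fun x => ?_⟩
  have : |f x * (1 + ‖x‖) ^ N| ≤ C := hC x
  rwa [abs_mul, abs_of_nonneg (a := (1 + ‖x‖) ^ N) (by positivity)] at this

lemma IsTestFunction.integrable {f : RSpace n → ℝ} (hf : IsTestFunction f) : Integrable f :=
  hf.continuous.integrable_of_hasCompactSupport hf.compactSupport

lemma IsTestFunction.hasDerivAt_line {f : RSpace n → F} (hf : IsTestFunction f)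
    (x v : RSpace n) (t : ℝ) :
    HasDerivAt (fun s : ℝ => f (x + s • v)) (_root_.fderiv ℝ f (x + t • v) v) t := by
  have h1 : HasDerivAt (fun s : ℝ => x + s • v) v t := by
    simpa using ((hasDerivAt_id t).smul_const v).const_add x
  exact (hf.differentiable _).hasFDerivAt.comp_hasDerivAt t h1

lemma fderiv_apply_eq_sum (f : RSpace n → ℝ) (x z : RSpace n) :
    fderiv ℝ f x z = ∑ k, z k * pderiv k f x := by
  conv_lhs => rw [← (EuclideanSpace.basisFun (Fin n) ℝ).sum_repr z]
  simp [map_sum, pderiv]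

lemma pderiv_comm {f : RSpace n → F} (hf : IsTestFunction f) (i j : Fin n) (x : RSpace n) :
    pderiv i (pderiv j f) x = pderiv j (pderiv i f) x := by
  have h : ∀ k l : Fin n, pderiv k (pderiv l f) x =
      _root_.fderiv ℝ (_root_.fderiv ℝ f) x (EuclideanSpace.single k 1)
        (EuclideanSpace.single l 1) := by
    intro k l
    unfold pderiv
    rw [fderiv_clm_apply (hf.fderiv.differentiable x) (differentiableAt_const _)]
    simp
  rw [h, h]
  have := (hf.smooth.contDiffAt (x := x)).isSymmSndFDerivAt
    (by simpa using WithTop.coe_le_coe.2 (le_top (a := (2 : ℕ∞))))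
  exact this _ _

end TestFunctions

section Heat

variable {n : ℕ}

/-- The Gaussian density `exp (-π |z|²)`, of total mass one. -/
noncomputable def gaussWeight (z : RSpace n) : ℝ := Real.exp (-Real.pi * ‖z‖ ^ 2)

/-- The weight `(1 + |x|)^(-(n + 1))`, integrable on `ℝⁿ`. -/
noncomputable def decayWeight (x : RSpace n) : ℝ := ((1 + ‖x‖) ^ (n + 1))⁻¹

/-- The Laplacian. -/
noncomputable def lap (f : RSpace n → ℝ) (x : RSpace n) : ℝ := ∑ k, pderiv k (pderiv k f) x

/-- The average of `f (x + a z)` over a Gaussian variable `z`. This is the heat extension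
of `f`, in the time parameter `a² / (4 π)`. -/
noncomputable def heat (f : RSpace n → ℝ) (a : ℝ) (x : RSpace n) : ℝ :=
  ∫ z, f (x + a • z) * gaussWeight z

lemma gaussWeight_pos (z : RSpace n) : 0 < gaussWeight z := Real.exp_pos _

lemma gaussWeight_le_one (z : RSpace n) : gaussWeight z ≤ 1 := by
  unfold gaussWeight
  rw [Real.exp_le_one_iff, neg_mul, neg_nonpos]
  positivity

lemma continuous_gaussWeight : Continuous (gaussWeight : RSpace n → ℝ) := by
  unfold gaussWeight; fun_prop

lemma integral_gaussWeight : ∫ z : RSpace n, gaussWeight z = 1 := by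
  unfold gaussWeight
  rw [GaussianFourier.integral_rexp_neg_mul_sq_norm Real.pi_pos, div_self Real.pi_ne_zero,
    Real.one_rpow]

lemma integrable_exp_neg_sq : Integrable fun z : RSpace n => Real.exp (-‖z‖ ^ 2) := by
  have h := GaussianFourier.integrable_cexp_neg_mul_sq_norm_add (V := RSpace n)
    (b := 1) (by simp) 0 0
  refine h.norm.congr (Filter.Eventually.of_forall fun z => ?_)
  simp only [Complex.norm_exp]
  congr 1
  simp [← Complex.ofReal_pow]

lemma integrable_moment (N : ℕ) :
    Integrable fun z : RSpace n => (1 + ‖z‖) ^ N * gaussWeight z := by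
  refine (integrable_exp_neg_sq.const_mul (N.factorial * Real.exp 2)).mono'
    (Continuous.aestronglyMeasurable ((by fun_prop : Continuous _).mul continuous_gaussWeight))
    (Filter.Eventually.of_forall fun z => ?_)
  have h0 := norm_nonneg z
  rw [Real.norm_eq_abs, abs_of_nonneg (mul_nonneg (by positivity) (gaussWeight_pos z).le)]
  have h1 : (1 + ‖z‖) ^ N ≤ N.factorial * Real.exp (1 + ‖z‖) := by
    have := Real.pow_div_factorial_le_exp (x := 1 + ‖z‖) (by positivity) N
    rwa [div_le_iff₀ (by positivity), mul_comm] at this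
  calc (1 + ‖z‖) ^ N * gaussWeight z
      ≤ N.factorial * Real.exp (1 + ‖z‖) * gaussWeight z :=
        mul_le_mul_of_nonneg_right h1 (gaussWeight_pos z).le
    _ = N.factorial * Real.exp (1 + ‖z‖ + -Real.pi * ‖z‖ ^ 2) := by
        rw [Real.exp_add (1 + ‖z‖), gaussWeight, mul_assoc]
    _ ≤ N.factorial * Real.exp (2 + -‖z‖ ^ 2) := by
        refine mul_le_mul_of_nonneg_left (Real.exp_le_exp.2 ?_) (by positivity)
        have : 3 * ‖z‖ ^ 2 ≤ Real.pi * ‖z‖ ^ 2 := by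
          gcongr; exact Real.pi_gt_three.le
        nlinarith [sq_nonneg (‖z‖ - 1)]
    _ = _ := by rw [Real.exp_add]; ring

lemma integrable_gaussWeight : Integrable (gaussWeight : RSpace n → ℝ) := by
  simpa using integrable_moment (n := n) 0

lemma decayWeight_le_one (x : RSpace n) : decayWeight x ≤ 1 := by
  unfold decayWeight
  exact inv_le_one_of_one_le₀ (one_le_pow₀ (by linarith [norm_nonneg x]))

lemma integrable_decayWeight : Integrable (decayWeight : RSpace n → ℝ) := by
  have h := integrable_one_add_norm (E := RSpace n) (μ := volume) (r := (n + 1 : ℕ))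
    (by simp)
  refine h.congr (Filter.Eventually.of_forall fun x => ?_)
  simp only [decayWeight]
  rw [Real.rpow_neg (by positivity), Real.rpow_natCast]

lemma hasDerivAt_gaussWeight (z : RSpace n) (k : Fin n) :
    HasLineDerivAt ℝ gaussWeight (-(2 * Real.pi) * z k * gaussWeight z) z
      (EuclideanSpace.single k (1 : ℝ)) := by
  have h1 : HasDerivAt (fun s : ℝ => z + s • EuclideanSpace.single k (1 : ℝ))
      (EuclideanSpace.single k (1 : ℝ)) 0 := by
    simpa using ((hasDerivAt_id (0 : ℝ)).smul_const
      (EuclideanSpace.single k (1 : ℝ))).const_add z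
  have h2 := ((h1.norm_sq).const_mul (-Real.pi)).exp
  refine h2.congr_deriv ?_
  simp only [zero_smul, add_zero, gaussWeight]
  rw [EuclideanSpace.inner_single_right]
  simp
  ring

variable {f : RSpace n → ℝ}

lemma IsTestFunction.integrable_heat (hf : IsTestFunction f) (a : ℝ) (x : RSpace n) :
    Integrable fun z => f (x + a • z) * gaussWeight z := by
  obtain ⟨C, -, hC⟩ := hf.exists_bound
  exact integrable_gaussWeight.bdd_mul
    (hf.continuous.comp (by fun_prop)).aestronglyMeasurable
    (Filter.Eventually.of_forall fun z => hC _)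

lemma heat_zero (f : RSpace n → ℝ) (x : RSpace n) : heat f 0 x = f x := by
  simp [heat, integral_const_mul, integral_gaussWeight]

lemma IsTestFunction.continuous_heat (hf : IsTestFunction f) (a : ℝ) :
    Continuous (heat f a) := by
  obtain ⟨C, hC0, hC⟩ := hf.exists_bound
  refine continuous_of_dominated (bound := fun z => C * gaussWeight z)
    (fun x => (hf.integrable_heat a x).aestronglyMeasurable)
    (fun x => Filter.Eventually.of_forall fun z => ?_) (integrable_gaussWeight.const_mul C)
    (Filter.Eventually.of_forall fun z =>
      (hf.continuous.comp (by fun_prop)).mul continuous_const)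
  rw [norm_mul, Real.norm_of_nonneg (gaussWeight_pos z).le]
  exact mul_le_mul_of_nonneg_right (hC _) (gaussWeight_pos z).le

lemma IsTestFunction.hasDerivAt_heat_space (hf : IsTestFunction f) (a : ℝ) (x : RSpace n)
    (k : Fin n) (t : ℝ) :
    HasDerivAt (fun s : ℝ => heat f a (x + s • EuclideanSpace.single k (1 : ℝ)))
      (heat (Coercivity.pderiv k f) a (x + t • EuclideanSpace.single k (1 : ℝ))) t := by
  obtain ⟨C, hC0, hC⟩ := (hf.pderiv k).exists_bound
  refine (hasDerivAt_integral_of_dominated_loc_of_deriv_le (s := Set.univ)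
    (F := fun (s : ℝ) (z : RSpace n) =>
      f (x + s • EuclideanSpace.single k (1 : ℝ) + a • z) * gaussWeight z)
    (F' := fun (s : ℝ) (z : RSpace n) => Coercivity.pderiv k f
      (x + s • EuclideanSpace.single k (1 : ℝ) + a • z) * gaussWeight z)
    (bound := fun z => C * gaussWeight z) Filter.univ_mem
    (Filter.Eventually.of_forall fun s => (hf.integrable_heat a _).aestronglyMeasurable)
    (hf.integrable_heat a _) ((hf.pderiv k).integrable_heat a _).aestronglyMeasurable
    (Filter.Eventually.of_forall fun z s _ => ?_) (integrable_gaussWeight.const_mul C)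
    (Filter.Eventually.of_forall fun z s _ => ?_)).2
  · rw [norm_mul, Real.norm_of_nonneg (gaussWeight_pos z).le]
    exact mul_le_mul_of_nonneg_right (hC _) (gaussWeight_pos z).le
  · have := (hf.hasDerivAt_line (x + a • z) (EuclideanSpace.single k (1 : ℝ)) s).mul_const
      (gaussWeight z)
    simp only [add_right_comm x (a • z)] at this
    exact this

lemma IsTestFunction.integral_mul_gaussWeight (hf : IsTestFunction f) (a : ℝ) (x : RSpace n)
    (k : Fin n) :
    Integrable (fun z => f (x + a • z) * (z k * gaussWeight z)) ∧
    ∫ z, f (x + a • z) * (z k * gaussWeight z) =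
      a / (2 * Real.pi) * heat (Coercivity.pderiv k f) a x := by
  obtain ⟨C, hC0, hC⟩ := hf.exists_bound
  have hz : Integrable fun z : RSpace n => z k * gaussWeight z := by
    refine (integrable_moment (n := n) 1).mono'
      (Continuous.aestronglyMeasurable ((by fun_prop : Continuous _).mul continuous_gaussWeight))
      (Filter.Eventually.of_forall fun z => ?_)
    rw [norm_mul, Real.norm_of_nonneg (gaussWeight_pos z).le]
    refine mul_le_mul_of_nonneg_right ?_ (gaussWeight_pos z).le
    have := PiLp.norm_apply_le z k
    rw [pow_one]; linarith
  have hint : Integrable (fun z => f (x + a • z) * (z k * gaussWeight z)) :=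
    hz.bdd_mul (hf.continuous.comp (by fun_prop)).aestronglyMeasurable
      (Filter.Eventually.of_forall fun z => hC _)
  refine ⟨hint, ?_⟩
  have key := integral_bilinear_hasLineDerivAt_right_eq_neg_left_of_integrable
    (B := ContinuousLinearMap.mul ℝ ℝ) (μ := (volume : Measure (RSpace n)))
    (f := fun z => f (x + a • z)) (f' := fun z => a * Coercivity.pderiv k f (x + a • z))
    (g := gaussWeight) (g' := fun z => -(2 * Real.pi) * z k * gaussWeight z)
    (v := EuclideanSpace.single k (1 : ℝ))
    (by
      simp only [ContinuousLinearMap.mul_apply', mul_assoc]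
      exact ((hf.pderiv k).integrable_heat a x).const_mul a)
    (by
      simp only [ContinuousLinearMap.mul_apply']
      refine (hint.const_mul (-(2 * Real.pi))).congr (Filter.Eventually.of_forall fun z => ?_)
      simp only; ring)
    (by simpa using hf.integrable_heat a x)
    (fun z _ => by
      have h := hf.hasDerivAt_line (x + a • z) (a • EuclideanSpace.single k (1 : ℝ)) 0
      unfold HasLineDerivAt
      have e : (fun t : ℝ => f (x + a • (z + t • EuclideanSpace.single k (1 : ℝ)))) =
          fun s : ℝ => f (x + a • z + s • a • EuclideanSpace.single k (1 : ℝ)) := by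
        funext s
        rw [smul_add, add_assoc, smul_comm]
      rw [e]
      refine h.congr_deriv ?_
      simp [Coercivity.pderiv])
    (fun z _ => hasDerivAt_gaussWeight z k)
  simp only [ContinuousLinearMap.mul_apply', mul_assoc, integral_const_mul] at key
  have e2 : ∫ z, f (x + a • z) * (-(2 * Real.pi) * (z k * gaussWeight z)) =
      -(2 * Real.pi) * ∫ z, f (x + a • z) * (z k * gaussWeight z) := by
    rw [← integral_const_mul]
    congr 1; funext z; ring
  rw [e2] at key
  have hpi := Real.pi_pos
  rw [div_mul_eq_mul_div, eq_div_iff (by positivity), heat]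
  linarith

lemma heat_sum {ι : Type} (s : Finset ι) {g : ι → RSpace n → ℝ}
    (hg : ∀ i ∈ s, IsTestFunction (g i)) (a : ℝ) (x : RSpace n) :
    heat (fun y => ∑ i ∈ s, g i y) a x = ∑ i ∈ s, heat (g i) a x := by
  unfold heat
  simp only [Finset.sum_mul]
  exact integral_finsetSum s fun i hi => (hg i hi).integrable_heat a x

lemma IsTestFunction.lap (hf : IsTestFunction f) : IsTestFunction (lap f) :=
  IsTestFunction.sum fun k _ => (hf.pderiv k).pderiv k

lemma IsTestFunction.hasDerivAt_heat_time (hf : IsTestFunction f) (a : ℝ) (x : RSpace n) :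
    HasDerivAt (fun s : ℝ => heat f s x)
      (a / (2 * Real.pi) * heat (Coercivity.lap f) a x) a := by
  obtain ⟨C, hC0, hC⟩ := hf.fderiv.exists_bound
  have hd := (hasDerivAt_integral_of_dominated_loc_of_deriv_le (s := Set.univ)
    (F := fun (s : ℝ) (z : RSpace n) => f (x + s • z) * gaussWeight z)
    (F' := fun (s : ℝ) (z : RSpace n) => _root_.fderiv ℝ f (x + s • z) z * gaussWeight z)
    (x₀ := a) (μ := volume)
    (bound := fun z => C * ((1 + ‖z‖) ^ 1 * gaussWeight z)) Filter.univ_mem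
    (Filter.Eventually.of_forall fun s => (hf.integrable_heat s _).aestronglyMeasurable)
    (hf.integrable_heat a _)
    (Continuous.aestronglyMeasurable (Continuous.mul
      ((hf.fderiv.continuous.comp (by fun_prop)).clm_apply continuous_id)
      continuous_gaussWeight))
    (Filter.Eventually.of_forall fun z s _ => by
      rw [norm_mul, Real.norm_of_nonneg (gaussWeight_pos z).le, ← mul_assoc]
      refine mul_le_mul_of_nonneg_right ?_ (gaussWeight_pos z).le
      refine (ContinuousLinearMap.le_of_opNorm_le _ (hC _) z).trans ?_
      rw [pow_one]
      exact mul_le_mul_of_nonneg_left (by linarith) hC0)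
    ((integrable_moment 1).const_mul C)
    (Filter.Eventually.of_forall fun z s _ =>
      (hf.hasDerivAt_line x z s).mul_const (gaussWeight z))).2
  refine hd.congr_deriv ?_
  have e1 : ∀ z : RSpace n, _root_.fderiv ℝ f (x + a • z) z * gaussWeight z =
      ∑ k, Coercivity.pderiv k f (x + a • z) * (z k * gaussWeight z) := by
    intro z
    rw [fderiv_apply_eq_sum, Finset.sum_mul]
    exact Finset.sum_congr rfl fun k _ => by ring
  simp only [e1]
  rw [integral_finsetSum _ fun k _ => ((hf.pderiv k).integral_mul_gaussWeight a x k).1]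
  rw [Finset.sum_congr rfl fun k _ => ((hf.pderiv k).integral_mul_gaussWeight a x k).2,
    ← Finset.mul_sum]
  congr 1
  exact (heat_sum _ (fun k _ => (hf.pderiv k).pderiv k) a x).symm

lemma IsTestFunction.exists_heat_decay (hf : IsTestFunction f) (A : ℝ) :
    ∃ C : ℝ, 0 ≤ C ∧ ∀ a : ℝ, |a| ≤ A → ∀ x, |heat f a x| ≤ C * decayWeight x := by
  obtain ⟨C, hC0, hC⟩ := hf.exists_decay (n + 1)
  have hI : 0 ≤ ∫ z : RSpace n, (1 + ‖z‖) ^ (n + 1) * gaussWeight z :=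
    integral_nonneg fun z => mul_nonneg (by positivity) (gaussWeight_pos z).le
  refine ⟨C * (1 + |A|) ^ (n + 1) * ∫ z : RSpace n, (1 + ‖z‖) ^ (n + 1) * gaussWeight z,
    by positivity, fun a ha x => ?_⟩
  have hpt : ∀ z : RSpace n, |f (x + a • z) * gaussWeight z| ≤
      C * (1 + |A|) ^ (n + 1) * decayWeight x * ((1 + ‖z‖) ^ (n + 1) * gaussWeight z) := by
    intro z
    rw [abs_mul, abs_of_pos (gaussWeight_pos z), ← mul_assoc]
    refine mul_le_mul_of_nonneg_right ?_ (gaussWeight_pos z).le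
    have h1 := hC (x + a • z)
    have haA : |a| ≤ |A| := ha.trans (le_abs_self A)
    have hx : 0 < (1 + ‖x‖) ^ (n + 1) := by positivity
    have h2 : (1 + ‖x‖) ≤ (1 + ‖x + a • z‖) * ((1 + |A|) * (1 + ‖z‖)) := by
      have h3 : ‖x‖ ≤ ‖x + a • z‖ + |A| * ‖z‖ := by
        calc ‖x‖ = ‖(x + a • z) - a • z‖ := by simp
          _ ≤ ‖x + a • z‖ + ‖a • z‖ := norm_sub_le _ _
          _ ≤ _ := by
            rw [norm_smul, Real.norm_eq_abs]
            gcongr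
      have h4 : 0 ≤ ‖x + a • z‖ := norm_nonneg _
      have h5 : 0 ≤ |A| := abs_nonneg _
      have h6 : 0 ≤ ‖z‖ := norm_nonneg _
      have h7 : 0 ≤ |A| * ‖z‖ := by positivity
      have h8 : 0 ≤ ‖x + a • z‖ * (|A| + ‖z‖ + |A| * ‖z‖) := by positivity
      nlinarith
    have h9 : (1 + ‖x‖) ^ (n + 1) ≤
        (1 + ‖x + a • z‖) ^ (n + 1) * ((1 + |A|) ^ (n + 1) * (1 + ‖z‖) ^ (n + 1)) := by
      rw [← mul_pow, ← mul_pow]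
      exact pow_le_pow_left₀ (by positivity) h2 _
    rw [decayWeight, show C * (1 + |A|) ^ (n + 1) * ((1 + ‖x‖) ^ (n + 1))⁻¹ * (1 + ‖z‖) ^ (n + 1)
      = (C * ((1 + |A|) ^ (n + 1) * (1 + ‖z‖) ^ (n + 1))) / (1 + ‖x‖) ^ (n + 1) by
        field_simp, le_div_iff₀ hx]
    calc |f (x + a • z)| * (1 + ‖x‖) ^ (n + 1)
        ≤ |f (x + a • z)| * ((1 + ‖x + a • z‖) ^ (n + 1) *
          ((1 + |A|) ^ (n + 1) * (1 + ‖z‖) ^ (n + 1))) := by gcongr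
      _ = (|f (x + a • z)| * (1 + ‖x + a • z‖) ^ (n + 1)) *
          ((1 + |A|) ^ (n + 1) * (1 + ‖z‖) ^ (n + 1)) := by ring
      _ ≤ _ := by gcongr
  calc |heat f a x| ≤ ∫ z, |f (x + a • z) * gaussWeight z| := abs_integral_le_integral_abs
    _ ≤ ∫ z, C * (1 + |A|) ^ (n + 1) * decayWeight x * ((1 + ‖z‖) ^ (n + 1) * gaussWeight z) :=
        integral_mono (hf.integrable_heat a x).abs ((integrable_moment _).const_mul _) hpt
    _ = _ := by rw [integral_const_mul]; ring

lemma IsTestFunction.integrable_heat_space (hf : IsTestFunction f) (a : ℝ) :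
    Integrable (heat f a) := by
  obtain ⟨C, -, hC⟩ := hf.exists_heat_decay |a|
  exact (integrable_decayWeight.const_mul C).mono' (hf.continuous_heat a).aestronglyMeasurable
    (Filter.Eventually.of_forall fun x => hC a le_rfl x)

lemma IsTestFunction.abs_heat_le (hf : IsTestFunction f) {a : ℝ} (ha : a ≠ 0)
    (x : RSpace n) : |heat f a x| ≤ |(a ^ n)⁻¹| * ∫ y, |f y| := by
  have hi := hf.integrable_heat a x
  have h1 : Integrable fun z => |f (x + a • z)| := by
    have : Integrable fun y => |f (x + y)| := (hf.integrable.comp_add_left x).abs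
    exact this.comp_smul ha
  calc |heat f a x| ≤ ∫ z, |f (x + a • z) * gaussWeight z| := abs_integral_le_integral_abs
    _ ≤ ∫ z, |f (x + a • z)| := by
        refine integral_mono hi.abs h1 fun z => ?_
        simp only [abs_mul, abs_of_pos (gaussWeight_pos z)]
        exact mul_le_of_le_one_right (abs_nonneg _) (gaussWeight_le_one z)
    _ = |(a ^ n)⁻¹| * ∫ y, |f (x + y)| := by
        rw [Measure.integral_comp_smul volume (fun y => |f (x + y)|) a]
        simp
    _ = _ := by rw [integral_add_left_eq_self (fun y => |f y|) x]

lemma IsTestFunction.integral_abs_heat_le (hf : IsTestFunction f) (a : ℝ) :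
    ∫ x, |heat f a x| ≤ ∫ y, |f y| := by
  have hm : AEMeasurable (Function.uncurry fun (x z : RSpace n) =>
      ‖f (x + a • z)‖ₑ * ‖gaussWeight z‖ₑ) (volume.prod volume) := by
    have : Continuous fun p : RSpace n × RSpace n => f (p.1 + a • p.2) :=
      hf.continuous.comp (by fun_prop)
    exact (this.measurable.enorm.mul
      ((continuous_gaussWeight.comp continuous_snd).measurable.enorm)).aemeasurable
  have h1 : ∫⁻ x, ‖heat f a x‖ₑ ≤ ∫⁻ y, ‖f y‖ₑ := by
    calc ∫⁻ x, ‖heat f a x‖ₑ ≤ ∫⁻ x, ∫⁻ z, ‖f (x + a • z)‖ₑ * ‖gaussWeight z‖ₑ := by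
          refine lintegral_mono fun x => ?_
          refine (enorm_integral_le_lintegral_enorm _).trans_eq ?_
          simp only [enorm_mul]
      _ = ∫⁻ z, ∫⁻ x, ‖f (x + a • z)‖ₑ * ‖gaussWeight z‖ₑ := lintegral_lintegral_swap hm
      _ = ∫⁻ z : RSpace n, (∫⁻ y, ‖f y‖ₑ) * ‖gaussWeight z‖ₑ := by
          refine lintegral_congr fun z => ?_
          rw [lintegral_mul_const' _ _ (by simp),
            lintegral_add_right_eq_self (fun y => ‖f y‖ₑ) (a • z)]
      _ = ∫⁻ y, ‖f y‖ₑ := by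
          rw [lintegral_const_mul' _ _ hf.integrable.2.ne]
          have : ∫⁻ z : RSpace n, ‖gaussWeight z‖ₑ = 1 := by
            rw [← ofReal_integral_norm_eq_lintegral_enorm integrable_gaussWeight]
            simp only [Real.norm_of_nonneg (gaussWeight_pos _).le, integral_gaussWeight,
              ENNReal.ofReal_one]
          rw [this, mul_one]
  have h2 := ofReal_integral_norm_eq_lintegral_enorm (hf.integrable_heat_space a)
  have h3 := ofReal_integral_norm_eq_lintegral_enorm hf.integrable
  rw [← h2, ← h3, ENNReal.ofReal_le_ofReal_iff (integral_nonneg fun _ => norm_nonneg _)] at h1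
  exact h1

end Heat

section Bilinear

variable {n : ℕ} {f g : RSpace n → ℝ}

lemma IsTestFunction.exists_heat_bound (hf : IsTestFunction f) (A : ℝ) :
    ∃ C : ℝ, 0 ≤ C ∧ ∀ a : ℝ, |a| ≤ A → ∀ x, |heat f a x| ≤ C := by
  obtain ⟨C, hC0, hC⟩ := hf.exists_heat_decay A
  exact ⟨C, hC0, fun a ha x => (hC a ha x).trans
    (mul_le_of_le_one_right hC0 (decayWeight_le_one x))⟩

lemma IsTestFunction.integrable_mul_heat (hf : IsTestFunction f) (a : ℝ) {ψ : RSpace n → ℝ}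
    (hψ : Continuous ψ) {C : ℝ} (hC : ∀ x, |ψ x| ≤ C) :
    Integrable fun x => ψ x * heat f a x :=
  (hf.integrable_heat_space a).bdd_mul hψ.aestronglyMeasurable
    (Filter.Eventually.of_forall hC)

lemma IsTestFunction.hasLineDerivAt_heat (hf : IsTestFunction f) (a : ℝ) (x : RSpace n)
    (k : Fin n) : HasLineDerivAt ℝ (heat f a) (heat (Coercivity.pderiv k f) a x) x
      (EuclideanSpace.single k (1 : ℝ)) := by
  simpa only [HasLineDerivAt, zero_smul, add_zero] using hf.hasDerivAt_heat_space a x k 0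

lemma integral_mul_deriv_eq {ψ ψ' φ φ' : RSpace n → ℝ} {v : RSpace n}
    (h₁ : Integrable fun x => ψ' x * φ x) (h₂ : Integrable fun x => ψ x * φ' x)
    (h₃ : Integrable fun x => ψ x * φ x) (hψ : ∀ x, HasLineDerivAt ℝ ψ (ψ' x) x v)
    (hφ : ∀ x, HasLineDerivAt ℝ φ (φ' x) x v) :
    ∫ x, ψ x * φ' x = - ∫ x, ψ' x * φ x :=
  integral_bilinear_hasLineDerivAt_right_eq_neg_left_of_integrable
    (B := ContinuousLinearMap.mul ℝ ℝ) h₁ h₂ h₃ (fun x _ => hψ x) fun x _ => hφ x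

lemma IsTestFunction.integrable_heat_mul_heat (hf : IsTestFunction f) (hg : IsTestFunction g)
    (a : ℝ) : Integrable fun x => heat f a x * heat g a x := by
  obtain ⟨C, -, hC⟩ := hf.exists_heat_bound |a|
  exact hg.integrable_mul_heat a (hf.continuous_heat a) (hC a le_rfl)

lemma integral_heat_mul_heat_pderiv (hf : IsTestFunction f) (hg : IsTestFunction g) (a : ℝ)
    (k : Fin n) : ∫ x, heat f a x * heat (pderiv k g) a x =
      - ∫ x, heat (pderiv k f) a x * heat g a x :=
  integral_mul_deriv_eq ((hf.pderiv k).integrable_heat_mul_heat hg a)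
    (hf.integrable_heat_mul_heat (hg.pderiv k) a) (hf.integrable_heat_mul_heat hg a)
    (fun x => hf.hasLineDerivAt_heat a x k) fun x => hg.hasLineDerivAt_heat a x k

lemma heat_lap (hf : IsTestFunction f) (a : ℝ) (x : RSpace n) :
    heat (lap f) a x = ∑ k, heat (pderiv k (pderiv k f)) a x :=
  heat_sum _ (fun k _ => (hf.pderiv k).pderiv k) a x

lemma integral_heat_mul_heat_lap (hf : IsTestFunction f) (hg : IsTestFunction g) (a : ℝ) :
    ∫ x, heat f a x * heat (lap g) a x = ∫ x, heat (lap f) a x * heat g a x := by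
  simp only [heat_lap hf, heat_lap hg, Finset.mul_sum, Finset.sum_mul]
  rw [integral_finsetSum _ fun k _ => hf.integrable_heat_mul_heat ((hg.pderiv k).pderiv k) a,
    integral_finsetSum _ fun k _ => ((hf.pderiv k).pderiv k).integrable_heat_mul_heat hg a]
  refine Finset.sum_congr rfl fun k _ => ?_
  rw [integral_heat_mul_heat_pderiv hf (hg.pderiv k),
    integral_heat_mul_heat_pderiv (hf.pderiv k) hg, neg_neg]

/-- Differentiation in the parameter of an integral over `ℝⁿ`, with a polynomially decaying
derivative. -/
lemma hasDerivAt_integral_of_decay {Φ Φ' : ℝ → RSpace n → ℝ}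
    (hd : ∀ a x, HasDerivAt (fun s => Φ s x) (Φ' a x) a)
    (hb : ∀ A : ℝ, ∃ C : ℝ, ∀ a, |a| ≤ A → ∀ x, |Φ' a x| ≤ C * decayWeight x)
    (hi : ∀ a, Integrable (Φ a)) (hm : ∀ a, Continuous (Φ' a)) (a : ℝ) :
    HasDerivAt (fun s => ∫ x, Φ s x) (∫ x, Φ' a x) a := by
  obtain ⟨C, hC⟩ := hb (|a| + 1)
  refine (hasDerivAt_integral_of_dominated_loc_of_deriv_le (s := Metric.ball a 1)
    (bound := fun x => C * decayWeight x) (Metric.ball_mem_nhds a one_pos)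
    (Filter.Eventually.of_forall fun s => (hi s).aestronglyMeasurable) (hi a)
    (hm a).aestronglyMeasurable (Filter.Eventually.of_forall fun x s hs => ?_)
    (integrable_decayWeight.const_mul C)
    (Filter.Eventually.of_forall fun x s _ => hd s x)).2
  refine hC s ?_ x
  have h1 : |s - a| < 1 := hs
  have h2 : |s| ≤ |s - a| + |a| := by simpa using abs_add_le (s - a) a
  linarith

lemma hasDerivAt_integral_heat_mul_heat (hf : IsTestFunction f) (hg : IsTestFunction g) (a : ℝ) :
    HasDerivAt (fun s => ∫ x, heat f s x * heat g s x)
      (a / (2 * Real.pi) * (2 * ∫ x, heat (lap f) a x * heat g a x)) a := by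
  have h := hasDerivAt_integral_of_decay
    (Φ := fun s x => heat f s x * heat g s x)
    (Φ' := fun s x => s / (2 * Real.pi) * heat (lap f) s x * heat g s x +
      heat f s x * (s / (2 * Real.pi) * heat (lap g) s x))
    (fun s x => (hf.hasDerivAt_heat_time s x).mul (hg.hasDerivAt_heat_time s x))
    (fun A => by
      obtain ⟨C₁, h10, h1⟩ := hf.lap.exists_heat_bound A
      obtain ⟨C₂, h20, h2⟩ := hg.exists_heat_decay A
      obtain ⟨C₃, h30, h3⟩ := hf.exists_heat_bound A
      obtain ⟨C₄, h40, h4⟩ := hg.lap.exists_heat_decay A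
      refine ⟨|A| / (2 * Real.pi) * C₁ * C₂ + C₃ * (|A| / (2 * Real.pi) * C₄), fun s hs x => ?_⟩
      have hpi := Real.pi_pos
      have hsA : |s| ≤ |A| := hs.trans (le_abs_self A)
      refine (abs_add_le _ _).trans ?_
      simp only [abs_mul, abs_div, abs_two, abs_of_pos hpi]
      calc |s| / (2 * Real.pi) * |heat (lap f) s x| * |heat g s x| +
            |heat f s x| * (|s| / (2 * Real.pi) * |heat (lap g) s x|)
          ≤ |A| / (2 * Real.pi) * C₁ * (C₂ * decayWeight x) +
            C₃ * (|A| / (2 * Real.pi) * (C₄ * decayWeight x)) := by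
              gcongr
              exacts [h1 s hs x, h2 s hs x, h3 s hs x, h4 s hs x]
        _ = _ := by ring)
    (fun s => hf.integrable_heat_mul_heat hg s)
    (fun s => ((continuous_const.mul (hf.lap.continuous_heat s)).mul (hg.continuous_heat s)).add
      ((hf.continuous_heat s).mul (continuous_const.mul (hg.lap.continuous_heat s)))) a
  refine h.congr_deriv ?_
  have e : ∀ x, a / (2 * Real.pi) * heat (lap f) a x * heat g a x +
      heat f a x * (a / (2 * Real.pi) * heat (lap g) a x) = a / (2 * Real.pi) *
        (heat (lap f) a x * heat g a x + heat f a x * heat (lap g) a x) := fun x => by ring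
  simp only [e]
  rw [integral_const_mul, integral_add (hf.lap.integrable_heat_mul_heat hg a)
    (hf.integrable_heat_mul_heat hg.lap a), integral_heat_mul_heat_lap hf hg]
  ring

lemma exists_bound_on_square {b : ℝ → ℝ → ℝ} (hb : Continuous fun z : ℝ × ℝ => b z.1 z.2)
    (R : ℝ) : ∃ C : ℝ, 0 ≤ C ∧ ∀ ζ η, |ζ| ≤ R → |η| ≤ R → |b ζ η| ≤ C := by
  obtain ⟨C, hC⟩ := ((isCompact_Icc (a := -R) (b := R)).prod
    (isCompact_Icc (a := -R) (b := R))).exists_bound_of_continuousOn hb.continuousOn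
  exact ⟨|C|, abs_nonneg _, fun ζ η hζ hη =>
    (hC (ζ, η) ⟨abs_le.1 hζ, abs_le.1 hη⟩).trans (le_abs_self C)⟩

variable {p q C δ : ℝ}

lemma Bellman.exists_lipschitz (b : Bellman p q C δ) (R : ℝ) :
    ∃ L : ℝ, 0 ≤ L ∧ ∀ ζ η, |ζ| ≤ R → |η| ≤ R → |b.B ζ η| ≤ L * (|ζ| + |η|) := by
  obtain ⟨L₁, h10, h1⟩ := exists_bound_on_square b.cont₁ R
  obtain ⟨L₂, h20, h2⟩ := exists_bound_on_square b.cont₂ R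
  refine ⟨L₁ + L₂, by positivity, fun ζ η hζ hη => ?_⟩
  have hd : ∀ t : ℝ, HasDerivAt (fun s => b.B (s * ζ) (s * η))
      (b.B₁ (t * ζ) (t * η) * ζ + b.B₂ (t * ζ) (t * η) * η) t := fun t =>
    b.deriv (by simpa using (hasDerivAt_id t).mul_const ζ)
      (by simpa using (hasDerivAt_id t).mul_const η)
  have h := norm_image_sub_le_of_norm_deriv_le_segment_01'
    (f := fun s => b.B (s * ζ) (s * η)) (C := (L₁ + L₂) * (|ζ| + |η|))
    (fun t _ => (hd t).hasDerivWithinAt) (fun t ht => by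
      have h3 : ∀ c : ℝ, |c| ≤ R → |t * c| ≤ R := fun c hc => by
        rw [abs_mul, abs_of_nonneg ht.1]
        exact (mul_le_of_le_one_left (abs_nonneg c) ht.2.le).trans hc
      refine (norm_add_le _ _).trans ?_
      rw [norm_mul, norm_mul]
      simp only [Real.norm_eq_abs]
      have h4 := h1 _ _ (h3 ζ hζ) (h3 η hη)
      have h5 := h2 _ _ (h3 ζ hζ) (h3 η hη)
      calc _ ≤ L₁ * |ζ| + L₂ * |η| := by gcongr
        _ ≤ (L₁ + L₂) * (|ζ| + |η|) := by nlinarith [abs_nonneg ζ, abs_nonneg η])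
  simpa [b.zero] using h

lemma Bellman.integrable_heat (b : Bellman p q C δ) (hf : IsTestFunction f)
    (hg : IsTestFunction g) (a : ℝ) : Integrable fun x => b.B (heat f a x) (heat g a x) := by
  obtain ⟨R₁, h10, h1⟩ := hf.exists_heat_bound |a|
  obtain ⟨R₂, h20, h2⟩ := hg.exists_heat_bound |a|
  obtain ⟨L, hL0, hL⟩ := b.exists_lipschitz (max R₁ R₂)
  refine (((hf.integrable_heat_space a).abs.add (hg.integrable_heat_space a).abs).const_mul
    L).mono' (b.cont.comp ((hf.continuous_heat a).prodMk
      (hg.continuous_heat a))).aestronglyMeasurable (Filter.Eventually.of_forall fun x => ?_)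
  exact hL _ _ ((h1 a le_rfl x).trans (le_max_left _ _)) ((h2 a le_rfl x).trans (le_max_right _ _))

/-- The Hessian of a Bellman function, applied to the `k`-th derivatives of the heat extensions. -/
noncomputable def Bellman.hessHeat (b : Bellman p q C δ) (f g : RSpace n → ℝ) (k : Fin n) (a : ℝ)
    (x : RSpace n) : ℝ :=
  b.B₁₁ (heat f a x) (heat g a x) * heat (pderiv k f) a x ^ 2 +
    2 * b.B₁₂ (heat f a x) (heat g a x) * heat (pderiv k f) a x * heat (pderiv k g) a x +
    b.B₂₂ (heat f a x) (heat g a x) * heat (pderiv k g) a x ^ 2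

lemma integrable_comp_heat_mul (hf : IsTestFunction f) (hg : IsTestFunction g) {β : ℝ → ℝ → ℝ}
    (hβ : Continuous fun z : ℝ × ℝ => β z.1 z.2) {h : RSpace n → ℝ} (hh : IsTestFunction h)
    (a : ℝ) : Integrable fun x => β (heat f a x) (heat g a x) * heat h a x := by
  obtain ⟨R₁, h10, h1⟩ := hf.exists_heat_bound |a|
  obtain ⟨R₂, h20, h2⟩ := hg.exists_heat_bound |a|
  obtain ⟨L, hL0, hL⟩ := exists_bound_on_square hβ (max R₁ R₂)
  exact hh.integrable_mul_heat a
    (hβ.comp ((hf.continuous_heat a).prodMk (hg.continuous_heat a)))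
    fun x => hL _ _ ((h1 a le_rfl x).trans (le_max_left _ _))
      ((h2 a le_rfl x).trans (le_max_right _ _))

lemma integrable_comp_heat_mul_mul (hf : IsTestFunction f) (hg : IsTestFunction g)
    {β : ℝ → ℝ → ℝ} (hβ : Continuous fun z : ℝ × ℝ => β z.1 z.2) {h j : RSpace n → ℝ}
    (hh : IsTestFunction h) (hj : IsTestFunction j) (a : ℝ) :
    Integrable fun x => β (heat f a x) (heat g a x) * heat h a x * heat j a x := by
  obtain ⟨R, -, hR⟩ := hj.exists_heat_bound |a|
  refine ((integrable_comp_heat_mul hf hg hβ hh a).bdd_mul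
    (hj.continuous_heat a).aestronglyMeasurable
    (Filter.Eventually.of_forall fun x => hR a le_rfl x)).congr
      (Filter.Eventually.of_forall fun x => mul_comm _ _)

lemma Bellman.integrable_hessHeat (b : Bellman p q C δ) (hf : IsTestFunction f)
    (hg : IsTestFunction g) (k : Fin n) (a : ℝ) : Integrable (b.hessHeat f g k a) := by
  refine (((integrable_comp_heat_mul_mul hf hg b.cont₁₁ (hf.pderiv k) (hf.pderiv k) a).add
    ((integrable_comp_heat_mul_mul hf hg b.cont₁₂ (hf.pderiv k) (hg.pderiv k) a).const_mul
      2)).add (integrable_comp_heat_mul_mul hf hg b.cont₂₂ (hg.pderiv k) (hg.pderiv k) a)).congr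
        (Filter.Eventually.of_forall fun x => ?_)
  simp only [hessHeat, Pi.add_apply]
  ring

lemma Bellman.integral_pderiv_pderiv (b : Bellman p q C δ) (hf : IsTestFunction f)
    (hg : IsTestFunction g) (k : Fin n) (a : ℝ) :
    (∫ x, b.B₁ (heat f a x) (heat g a x) * heat (pderiv k (pderiv k f)) a x) +
      ∫ x, b.B₂ (heat f a x) (heat g a x) * heat (pderiv k (pderiv k g)) a x =
        - ∫ x, b.hessHeat f g k a x := by
  have hfk := hf.pderiv k
  have hgk := hg.pderiv k
  have i11 := integrable_comp_heat_mul_mul hf hg b.cont₁₁ hfk hfk a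
  have i12 := integrable_comp_heat_mul_mul hf hg b.cont₁₂ hgk hfk a
  have i21 := integrable_comp_heat_mul_mul hf hg b.cont₁₂ hfk hgk a
  have i22 := integrable_comp_heat_mul_mul hf hg b.cont₂₂ hgk hgk a
  have i1 : Integrable fun x => (b.B₁₁ (heat f a x) (heat g a x) * heat (pderiv k f) a x +
      b.B₁₂ (heat f a x) (heat g a x) * heat (pderiv k g) a x) * heat (pderiv k f) a x :=
    (i11.add i12).congr (Filter.Eventually.of_forall fun x => (add_mul _ _ _).symm)
  have i2 : Integrable fun x => (b.B₁₂ (heat f a x) (heat g a x) * heat (pderiv k f) a x +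
      b.B₂₂ (heat f a x) (heat g a x) * heat (pderiv k g) a x) * heat (pderiv k g) a x :=
    (i21.add i22).congr (Filter.Eventually.of_forall fun x => (add_mul _ _ _).symm)
  have e1 := integral_mul_deriv_eq (v := EuclideanSpace.single k (1 : ℝ)) i1
    (integrable_comp_heat_mul hf hg b.cont₁ (hfk.pderiv k) a)
    (integrable_comp_heat_mul hf hg b.cont₁ hfk a)
    (fun x => by
      have := b.deriv₁ (hf.hasDerivAt_heat_space a x k 0) (hg.hasDerivAt_heat_space a x k 0)
      simpa only [HasLineDerivAt, zero_smul, add_zero] using this)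
    (fun x => hfk.hasLineDerivAt_heat a x k)
  have e2 := integral_mul_deriv_eq (v := EuclideanSpace.single k (1 : ℝ)) i2
    (integrable_comp_heat_mul hf hg b.cont₂ (hgk.pderiv k) a)
    (integrable_comp_heat_mul hf hg b.cont₂ hgk a)
    (fun x => by
      have := b.deriv₂ (hf.hasDerivAt_heat_space a x k 0) (hg.hasDerivAt_heat_space a x k 0)
      simpa only [HasLineDerivAt, zero_smul, add_zero] using this)
    (fun x => hgk.hasLineDerivAt_heat a x k)
  rw [e1, e2, ← neg_add, ← integral_add i1 i2]
  congr 2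
  funext x
  simp only [hessHeat]
  ring

lemma Bellman.hasDerivAt_integral_heat (b : Bellman p q C δ) (hf : IsTestFunction f)
    (hg : IsTestFunction g) (a : ℝ) :
    HasDerivAt (fun s => ∫ x, b.B (heat f s x) (heat g s x))
      (-(a / (2 * Real.pi) * ∫ x, ∑ k, b.hessHeat f g k a x)) a := by
  have h := hasDerivAt_integral_of_decay
    (Φ := fun s x => b.B (heat f s x) (heat g s x))
    (Φ' := fun s x => b.B₁ (heat f s x) (heat g s x) * (s / (2 * Real.pi) * heat (lap f) s x) +
      b.B₂ (heat f s x) (heat g s x) * (s / (2 * Real.pi) * heat (lap g) s x))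
    (fun s x => b.deriv (hf.hasDerivAt_heat_time s x) (hg.hasDerivAt_heat_time s x))
    (fun A => by
      obtain ⟨R₁, h10, h1⟩ := hf.exists_heat_bound A
      obtain ⟨R₂, h20, h2⟩ := hg.exists_heat_bound A
      obtain ⟨L₁, hL10, hL1⟩ := exists_bound_on_square b.cont₁ (max R₁ R₂)
      obtain ⟨L₂, hL20, hL2⟩ := exists_bound_on_square b.cont₂ (max R₁ R₂)
      obtain ⟨C₁, hC10, hC1⟩ := hf.lap.exists_heat_decay A
      obtain ⟨C₂, hC20, hC2⟩ := hg.lap.exists_heat_decay A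
      refine ⟨L₁ * (|A| / (2 * Real.pi) * C₁) + L₂ * (|A| / (2 * Real.pi) * C₂),
        fun s hs x => ?_⟩
      have hpi := Real.pi_pos
      have hsA : |s| ≤ |A| := hs.trans (le_abs_self A)
      have hb1 := (h1 s hs x).trans (le_max_left R₁ R₂)
      have hb2 := (h2 s hs x).trans (le_max_right R₁ R₂)
      refine (abs_add_le _ _).trans ?_
      simp only [abs_mul, abs_div, abs_two, abs_of_pos hpi]
      calc _ ≤ L₁ * (|A| / (2 * Real.pi) * (C₁ * decayWeight x)) +
            L₂ * (|A| / (2 * Real.pi) * (C₂ * decayWeight x)) := by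
              gcongr
              exacts [hL1 _ _ hb1 hb2, hC1 s hs x, hL2 _ _ hb1 hb2, hC2 s hs x]
        _ = _ := by ring)
    (fun s => b.integrable_heat hf hg s)
    (fun s => by
      have hc := (hf.continuous_heat s).prodMk (hg.continuous_heat s)
      exact ((b.cont₁.comp hc).mul (continuous_const.mul (hf.lap.continuous_heat s))).add
        ((b.cont₂.comp hc).mul (continuous_const.mul (hg.lap.continuous_heat s)))) a
  refine h.congr_deriv ?_
  have e : ∀ x, b.B₁ (heat f a x) (heat g a x) * (a / (2 * Real.pi) * heat (lap f) a x) +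
      b.B₂ (heat f a x) (heat g a x) * (a / (2 * Real.pi) * heat (lap g) a x) =
      a / (2 * Real.pi) * ∑ k,
        (b.B₁ (heat f a x) (heat g a x) * heat (pderiv k (pderiv k f)) a x +
          b.B₂ (heat f a x) (heat g a x) * heat (pderiv k (pderiv k g)) a x) := fun x => by
    rw [heat_lap hf, heat_lap hg, Finset.sum_add_distrib, ← Finset.mul_sum, ← Finset.mul_sum]
    ring
  have i1 := fun k => integrable_comp_heat_mul hf hg b.cont₁ ((hf.pderiv k).pderiv k) a
  have i2 := fun k => integrable_comp_heat_mul hf hg b.cont₂ ((hg.pderiv k).pderiv k) a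
  have i12 : ∀ k, Integrable fun x =>
      b.B₁ (heat f a x) (heat g a x) * heat (pderiv k (pderiv k f)) a x +
        b.B₂ (heat f a x) (heat g a x) * heat (pderiv k (pderiv k g)) a x :=
    fun k => (i1 k).add (i2 k)
  simp only [e]
  rw [integral_const_mul, integral_finsetSum _ fun k _ => i12 k,
    integral_finsetSum _ fun k _ => b.integrable_hessHeat hf hg k a, ← mul_neg,
    ← Finset.sum_neg_distrib]
  congr 1
  refine Finset.sum_congr rfl fun k _ => ?_
  rw [← b.integral_pderiv_pderiv hf hg k a]
  exact integral_add (i1 k) (i2 k)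

lemma Bellman.le_sum_hessHeat (b : Bellman p q C δ) (f g : RSpace n → ℝ) (i j : Fin n)
    (a : ℝ) (x : RSpace n) :
    2 * (heat (pderiv i f) a x * heat (pderiv j g) a x) ≤ ∑ k, b.hessHeat f g k a x := by
  obtain ⟨τ, hτ, h⟩ := b.hess (heat f a x) (heat g a x)
  have h1 : τ * heat (pderiv i f) a x ^ 2 ≤ ∑ k, τ * heat (pderiv k f) a x ^ 2 :=
    Finset.single_le_sum (f := fun k => τ * heat (pderiv k f) a x ^ 2)
      (fun k _ => by positivity) (Finset.mem_univ i)
  have h2 : τ⁻¹ * heat (pderiv j g) a x ^ 2 ≤ ∑ k, τ⁻¹ * heat (pderiv k g) a x ^ 2 :=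
    Finset.single_le_sum (f := fun k => τ⁻¹ * heat (pderiv k g) a x ^ 2)
      (fun k _ => by positivity) (Finset.mem_univ j)
  have h3 : ∑ k, τ * heat (pderiv k f) a x ^ 2 + ∑ k, τ⁻¹ * heat (pderiv k g) a x ^ 2 ≤
      ∑ k, b.hessHeat f g k a x := by
    rw [← Finset.sum_add_distrib]
    exact Finset.sum_le_sum fun k _ => h _ _
  have h4 : 0 ≤ τ * (heat (pderiv i f) a x - τ⁻¹ * heat (pderiv j g) a x) ^ 2 := by positivity
  have h5 : τ * (heat (pderiv i f) a x - τ⁻¹ * heat (pderiv j g) a x) ^ 2 =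
      τ * heat (pderiv i f) a x ^ 2 + τ⁻¹ * heat (pderiv j g) a x ^ 2 -
        2 * (heat (pderiv i f) a x * heat (pderiv j g) a x) := by
    field_simp; ring
  linarith

/-- If `Δ w` is a sum of second derivatives `∂ᵢ ∂ⱼ F`, then the pairing of `w` with `g` is
controlled by the integrals of a Bellman function of `F` and `g`. -/
theorem integral_mul_le_sum_bellman (hn : n ≠ 0) {ι : Type} [Fintype ι] {k l : ι → Fin n}
    {F : ι → RSpace n → ℝ} {w : RSpace n → ℝ} (hF : ∀ m, IsTestFunction (F m))
    (hw : IsTestFunction w) (hg : IsTestFunction g)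
    (hlap : ∀ x, lap w x = ∑ m, pderiv (k m) (pderiv (l m) (F m)) x)
    (b : Bellman p q C δ) :
    ∫ x, w x * g x ≤ ∑ m, ∫ x, b.B (F m x) (g x) := by
  set J : ℝ → ℝ := fun a => ∫ x, heat w a x * heat g a x with hJ
  set φ : ι → ℝ → ℝ := fun m a => ∫ x, b.B (heat (F m) a x) (heat g a x) with hφ
  have hd : ∀ a, HasDerivAt (fun a => J a - ∑ m, φ m a)
      (a / (2 * Real.pi) * (2 * ∫ x, heat (lap w) a x * heat g a x) -
        ∑ m, -(a / (2 * Real.pi) * ∫ x, ∑ i, b.hessHeat (F m) g i a x)) a := fun a =>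
    (hasDerivAt_integral_heat_mul_heat hw hg a).sub
      (HasDerivAt.fun_sum fun m _ => b.hasDerivAt_integral_heat (hF m) hg a)
  have hJ' : ∀ a, ∫ x, heat (lap w) a x * heat g a x =
      -∑ m, ∫ x, heat (pderiv (l m) (F m)) a x * heat (pderiv (k m) g) a x := by
    intro a
    have e : lap w = fun x => ∑ m, pderiv (k m) (pderiv (l m) (F m)) x := funext hlap
    have hT := fun m => ((hF m).pderiv (l m)).pderiv (k m)
    simp only [e, heat_sum _ (fun m _ => hT m), Finset.sum_mul]
    rw [integral_finsetSum _ fun m _ => (hT m).integrable_heat_mul_heat hg a,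
      ← Finset.sum_neg_distrib]
    refine Finset.sum_congr rfl fun m _ => ?_
    rw [integral_heat_mul_heat_pderiv ((hF m).pderiv (l m)) hg, neg_neg]
  have hnonneg : ∀ a, 0 ≤ a → 0 ≤ a / (2 * Real.pi) * (2 * ∫ x, heat (lap w) a x * heat g a x) -
        ∑ m, -(a / (2 * Real.pi) * ∫ x, ∑ i, b.hessHeat (F m) g i a x) := by
    intro a ha
    have hle : ∑ m, 2 * ∫ x, heat (pderiv (l m) (F m)) a x * heat (pderiv (k m) g) a x ≤
        ∑ m, ∫ x, ∑ i, b.hessHeat (F m) g i a x := by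
      refine Finset.sum_le_sum fun m _ => ?_
      rw [← integral_const_mul]
      refine integral_mono ((((hF m).pderiv (l m)).integrable_heat_mul_heat
        (hg.pderiv (k m)) a).const_mul 2)
        (integrable_finsetSum _ fun i _ => b.integrable_hessHeat (hF m) hg i a)
        fun x => b.le_sum_hessHeat _ _ _ _ _ _
    rw [hJ', Finset.sum_neg_distrib, ← Finset.mul_sum]
    rw [← Finset.mul_sum] at hle
    have hc : 0 ≤ a / (2 * Real.pi) := div_nonneg ha (by positivity)
    have := mul_le_mul_of_nonneg_left hle hc
    linarith
  have hmono : MonotoneOn (fun a => J a - ∑ m, φ m a) (Set.Ici 0) := by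
    refine monotoneOn_of_deriv_nonneg (convex_Ici 0)
      (fun a _ => (hd a).continuousAt.continuousWithinAt)
      (fun a _ => (hd a).differentiableAt.differentiableWithinAt) fun a ha => ?_
    rw [interior_Ici] at ha
    rw [(hd a).deriv]
    exact hnonneg a (le_of_lt ha)
  have hJle : ∀ a : ℝ, 0 < a → J a ≤ (a ^ n)⁻¹ * ((∫ x, |w x|) * ∫ x, |g x|) := by
    intro a ha
    have h1 : ∀ x, |heat w a x| ≤ (a ^ n)⁻¹ * ∫ y, |w y| := fun x => by
      have := hw.abs_heat_le ha.ne' x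
      rwa [abs_of_pos (a := (a ^ n)⁻¹) (by positivity)] at this
    have hw0 : 0 ≤ ∫ y, |w y| := integral_nonneg fun _ => abs_nonneg _
    calc J a ≤ ∫ x, ((a ^ n)⁻¹ * ∫ y, |w y|) * |heat g a x| := by
          refine integral_mono (hw.integrable_heat_mul_heat hg a)
            ((hg.integrable_heat_space a).abs.const_mul _) fun x => ?_
          refine (le_abs_self _).trans ?_
          rw [abs_mul]
          exact mul_le_mul_of_nonneg_right (h1 x) (abs_nonneg _)
      _ = ((a ^ n)⁻¹ * ∫ y, |w y|) * ∫ x, |heat g a x| := integral_const_mul _ _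
      _ ≤ ((a ^ n)⁻¹ * ∫ y, |w y|) * ∫ x, |g x| := by
          exact mul_le_mul_of_nonneg_left (hg.integral_abs_heat_le a) (by positivity)
      _ = _ := by ring
  have hlim : Filter.Tendsto (fun a : ℝ => (a ^ n)⁻¹ * ((∫ x, |w x|) * ∫ x, |g x|))
      Filter.atTop (nhds 0) := by
    simpa using ((Filter.tendsto_pow_atTop hn).inv_tendsto_atTop).mul_const
      ((∫ x, |w x|) * ∫ x, |g x|)
  have hbound : ∀ a : ℝ, 0 < a → J 0 - ∑ m, φ m 0 ≤
      (a ^ n)⁻¹ * ((∫ x, |w x|) * ∫ x, |g x|) := fun a ha => by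
    have h1 := hmono (Set.self_mem_Ici) (Set.mem_Ici.2 ha.le) ha.le
    have h2 : 0 ≤ ∑ m, φ m a := Finset.sum_nonneg fun m _ =>
      integral_nonneg fun x => b.nonneg _ _
    have h3 := hJle a ha
    simp only at h1
    linarith
  have hfin := ge_of_tendsto hlim (Filter.eventually_atTop.2
    ⟨1, fun a ha => hbound a (lt_of_lt_of_le one_pos ha)⟩)
  have e0 : J 0 = ∫ x, w x * g x := by simp only [hJ, heat_zero]
  have e1 : ∀ m, φ m 0 = ∫ x, b.B (F m x) (g x) := fun m => by simp only [hφ, heat_zero]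
  rw [e0] at hfin
  simp only [e1] at hfin
  linarith

lemma IsTestFunction.integrable_rpow (hf : IsTestFunction f) (hp : 0 < p) :
    Integrable fun x => |f x| ^ p := by
  refine Continuous.integrable_of_hasCompactSupport
    (hf.continuous.abs.rpow_const fun x => Or.inr hp.le) ?_
  exact hf.compactSupport.comp_left (g := fun t : ℝ => |t| ^ p) (by simp [hp.ne'])

theorem integral_mul_le_sum_rpow (hn : n ≠ 0) {ι : Type} [Fintype ι] {k l : ι → Fin n}
    {F : ι → RSpace n → ℝ} {w : RSpace n → ℝ} (hF : ∀ m, IsTestFunction (F m))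
    (hw : IsTestFunction w) (hg : IsTestFunction g)
    (hlap : ∀ x, lap w x = ∑ m, pderiv (k m) (pderiv (l m) (F m)) x)
    (hp : 0 < p) (hq : 0 < q) (hC : 0 < C)
    (hb : ∀ δ : ℝ, 0 < δ → Nonempty (Bellman p q C δ)) :
    ∫ x, w x * g x ≤ C * ∑ m, ((∫ x, |F m x| ^ p) + ∫ x, |g x| ^ q) := by
  set S : ι → Set (RSpace n) := fun m => tsupport (F m) ∪ tsupport g with hS
  have hSc : ∀ m, IsCompact (S m) := fun m => (hF m).compactSupport.union hg.compactSupport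
  set V : ℝ := ∑ m, volume.real (S m) with hV
  have hV0 : 0 ≤ V := Finset.sum_nonneg fun m _ => measureReal_nonneg
  refine le_of_forall_pos_le_add fun ε hε => ?_
  obtain ⟨b⟩ := hb (ε / (C * (V + 1))) (by positivity)
  set δ := ε / (C * (V + 1)) with hδ
  have hδ0 : 0 < δ := by positivity
  have hCδ : C * δ * V ≤ ε := by
    have : C * δ * (V + 1) = ε := by rw [hδ]; field_simp
    nlinarith [mul_pos hC hδ0]
  refine (integral_mul_le_sum_bellman hn hF hw hg hlap b).trans ?_
  have key : ∀ m, ∫ x, b.B (F m x) (g x) ≤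
      C * ((∫ x, |F m x| ^ p) + ∫ x, |g x| ^ q) + C * δ * volume.real (S m) := by
    intro m
    have i1 := (hF m).integrable_rpow hp
    have i2 := hg.integrable_rpow hq
    have i3 : Integrable ((S m).indicator fun _ => δ) :=
      (integrable_indicator_iff (hSc m).measurableSet).2
        (integrableOn_const (hSc m).measure_lt_top.ne)
    have i12 : Integrable fun x => |F m x| ^ p + |g x| ^ q := i1.add i2
    have i0 : Integrable fun x => b.B (F m x) (g x) := by
      simpa only [heat_zero] using b.integrable_heat (hF m) hg 0
    calc ∫ x, b.B (F m x) (g x)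
        ≤ ∫ x, C * (|F m x| ^ p + |g x| ^ q + (S m).indicator (fun _ => δ) x) := by
          refine integral_mono i0 ((i12.add i3).const_mul C) fun x => ?_
          by_cases hx : x ∈ S m
          · simpa [Set.indicator_of_mem hx] using b.le (F m x) (g x)
          · have h1 : F m x = 0 := image_eq_zero_of_notMem_tsupport fun h => hx (Or.inl h)
            have h2 : g x = 0 := image_eq_zero_of_notMem_tsupport fun h => hx (Or.inr h)
            simp [Set.indicator_of_notMem hx, h1, h2, b.zero, hp.ne', hq.ne']
      _ = C * (((∫ x, |F m x| ^ p) + ∫ x, |g x| ^ q) + volume.real (S m) * δ) := by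
          rw [integral_const_mul, integral_add i12 i3, integral_add i1 i2,
            integral_indicator_const _ (hSc m).measurableSet, smul_eq_mul]
      _ = _ := by ring
  calc ∑ m, ∫ x, b.B (F m x) (g x)
      ≤ ∑ m, (C * ((∫ x, |F m x| ^ p) + ∫ x, |g x| ^ q) + C * δ * volume.real (S m)) :=
        Finset.sum_le_sum fun m _ => key m
    _ = C * ∑ m, ((∫ x, |F m x| ^ p) + ∫ x, |g x| ^ q) + C * δ * V := by
        rw [Finset.sum_add_distrib, ← Finset.mul_sum, ← Finset.mul_sum]
    _ ≤ _ := by linarith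

end Bilinear

section Estimate

variable {n : ℕ} {p q : ℝ} {w : RSpace n → ℝ}

/-- The smooth approximations `w (w² + ε)^((p - 2) / 2)` of the function `|w|^(p - 2) w`. -/
noncomputable def dualPower (p ε : ℝ) (w : RSpace n → ℝ) (x : RSpace n) : ℝ :=
  w x * (w x ^ 2 + ε) ^ ((p - 2) / 2)

lemma IsTestFunction.dualPower (hw : IsTestFunction w) {ε : ℝ} (hε : 0 < ε) (p : ℝ) :
    IsTestFunction (dualPower p ε w) := by
  refine ⟨?_, hw.compactSupport.mul_right⟩
  refine hw.smooth.mul (ContDiff.rpow_const_of_ne ((hw.smooth.pow 2).add contDiff_const)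
    fun x => ?_)
  positivity

lemma abs_dualPower_le (hp : 1 < p) {ε : ℝ} (hε : 0 < ε) (hε1 : ε ≤ 1) {M : ℝ}
    (hM : ∀ x, |w x| ≤ M) (x : RSpace n) :
    |dualPower p ε w x| ≤ (M ^ 2 + 1) ^ ((p - 1) / 2) := by
  have h0 : 0 < w x ^ 2 + ε := by positivity
  have hwM : w x ^ 2 ≤ M ^ 2 := by
    rw [← sq_abs (w x)]; exact pow_le_pow_left₀ (abs_nonneg _) (hM x) 2
  have h1 : |w x| ≤ (w x ^ 2 + ε) ^ (1 / 2 : ℝ) := by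
    rw [← Real.sqrt_eq_rpow]
    exact Real.abs_le_sqrt (by linarith)
  calc |dualPower p ε w x| = |w x| * (w x ^ 2 + ε) ^ ((p - 2) / 2) := by
        rw [dualPower, abs_mul, abs_of_pos (a := (_ : ℝ) ^ (_ : ℝ)) (by positivity)]
    _ ≤ (w x ^ 2 + ε) ^ (1 / 2 : ℝ) * (w x ^ 2 + ε) ^ ((p - 2) / 2) := by gcongr
    _ = (w x ^ 2 + ε) ^ ((p - 1) / 2) := by
        rw [← Real.rpow_add h0]; congr 1; ring
    _ ≤ _ := Real.rpow_le_rpow h0.le (by linarith) (by linarith)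

lemma tendsto_dualPower (p : ℝ) (w : RSpace n → ℝ) (x : RSpace n) :
    Filter.Tendsto (fun ε => dualPower p ε w x) (nhdsWithin 0 (Set.Ioi 0))
      (nhds (w x * |w x| ^ (p - 2))) := by
  rcases eq_or_ne (w x) 0 with h | h
  · simp [dualPower, h]
  · have hc : ContinuousAt (fun ε : ℝ => (w x ^ 2 + ε) ^ ((p - 2) / 2)) 0 :=
      ContinuousAt.rpow_const (by fun_prop) (Or.inl (by simpa using h))
    have h2 : (w x ^ 2 + 0) ^ ((p - 2) / 2) = |w x| ^ (p - 2) := by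
      rw [add_zero, ← sq_abs, ← Real.rpow_natCast, ← Real.rpow_mul (abs_nonneg _)]
      congr 1; push_cast; ring
    have := (hc.tendsto.mono_left (nhdsWithin_le_nhds (s := Set.Ioi 0))).const_mul (w x)
    rw [h2] at this
    exact this

lemma tendsto_integral_dualPower (hpq : p.HolderConjugate q) (hw : IsTestFunction w) :
    Filter.Tendsto (fun ε => ∫ x, w x * dualPower p ε w x) (nhdsWithin 0 (Set.Ioi 0))
      (nhds (∫ x, |w x| ^ p)) ∧
    Filter.Tendsto (fun ε => ∫ x, |dualPower p ε w x| ^ q) (nhdsWithin 0 (Set.Ioi 0))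
      (nhds (∫ x, |w x| ^ p)) := by
  have hp := hpq.lt
  have hp0 := hpq.pos
  have hq0 := hpq.symm.pos
  obtain ⟨M, hM0, hM⟩ := hw.exists_bound
  set D := (M ^ 2 + 1) ^ ((p - 1) / 2) with hD
  have hD0 : 0 ≤ D := by positivity
  have hbound : ∀ ε, 0 < ε → ε ≤ 1 → ∀ x, |dualPower p ε w x| ≤ D := fun ε h1 h2 x =>
    abs_dualPower_le hp h1 h2 hM x
  have hev : ∀ᶠ ε : ℝ in nhdsWithin 0 (Set.Ioi 0), 0 < ε ∧ ε ≤ 1 :=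
    Filter.eventually_and.2
      ⟨self_mem_nhdsWithin, mem_nhdsWithin_of_mem_nhds (Iic_mem_nhds one_pos)⟩
  have hint : ∀ c : ℝ, Integrable ((tsupport w).indicator fun _ => c) := fun c =>
    (integrable_indicator_iff hw.compactSupport.measurableSet).2
      (integrableOn_const hw.compactSupport.measure_lt_top.ne)
  have hwx : ∀ x, w x ≠ 0 → |w x| * |w x| ^ (p - 2) = |w x| ^ (p - 1) := fun x hx => by
    rw [← Real.rpow_one_add' (abs_nonneg _) (by linarith)]
    congr 1; ring
  constructor
  · refine tendsto_integral_filter_of_dominated_convergence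
      ((tsupport w).indicator fun _ => M * D) ?_ ?_ (hint _)
      (Filter.Eventually.of_forall fun x => ?_)
    · filter_upwards [hev] with ε hε
      exact (hw.continuous.mul (hw.dualPower hε.1 p).continuous).aestronglyMeasurable
    · filter_upwards [hev] with ε hε
      refine Filter.Eventually.of_forall fun x => ?_
      by_cases hx : x ∈ tsupport w
      · rw [Set.indicator_of_mem hx, norm_mul]
        exact mul_le_mul (hM x) (hbound ε hε.1 hε.2 x) (norm_nonneg _) hM0
      · simp [Set.indicator_of_notMem hx, image_eq_zero_of_notMem_tsupport hx]
    · have h := (tendsto_dualPower p w x).const_mul (w x)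
      convert h using 2
      rcases eq_or_ne (w x) 0 with hx | hx
      · simp [hx, hp0.ne']
      · rw [← mul_assoc, ← abs_mul_abs_self (w x), mul_assoc, hwx x hx, mul_comm,
          ← Real.rpow_add_one (abs_ne_zero.2 hx)]
        congr 1; ring
  · refine tendsto_integral_filter_of_dominated_convergence
      ((tsupport w).indicator fun _ => D ^ q) ?_ ?_ (hint _)
      (Filter.Eventually.of_forall fun x => ?_)
    · filter_upwards [hev] with ε hε
      exact ((hw.dualPower hε.1 p).continuous.abs.rpow_const
        fun _ => Or.inr hq0.le).aestronglyMeasurable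
    · filter_upwards [hev] with ε hε
      refine Filter.Eventually.of_forall fun x => ?_
      by_cases hx : x ∈ tsupport w
      · rw [Set.indicator_of_mem hx, Real.norm_of_nonneg (by positivity)]
        exact Real.rpow_le_rpow (abs_nonneg _) (hbound ε hε.1 hε.2 x) hq0.le
      · simp [dualPower, Set.indicator_of_notMem hx, image_eq_zero_of_notMem_tsupport hx,
          hq0.ne']
    · have h := ((tendsto_dualPower p w x).abs).rpow_const (p := q) (Or.inr hq0.le)
      convert h using 2
      rcases eq_or_ne (w x) 0 with hx | hx
      · simp [hx, hp0.ne', hq0.ne']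
      · rw [abs_mul, abs_of_nonneg (a := |w x| ^ (p - 2)) (by positivity), hwx x hx,
          ← Real.rpow_mul (abs_nonneg _), hpq.sub_one_mul_conj]

lemma pderiv_const_mul {f : RSpace n → ℝ} (hf : IsTestFunction f) (c : ℝ) (i : Fin n) :
    pderiv i (fun x => c * f x) = fun x => c * pderiv i f x := by
  funext x
  simp only [pderiv]
  rw [fderiv_const_mul (hf.differentiable x)]
  rfl

lemma pderiv_add {F : Type} [NormedAddCommGroup F] [NormedSpace ℝ F] {f g : RSpace n → F}
    (hf : IsTestFunction f) (hg : IsTestFunction g)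
    (i : Fin n) : pderiv i (fun x => f x + g x) = fun x => pderiv i f x + pderiv i g x := by
  funext x
  simp only [pderiv]
  rw [fderiv_fun_add (hf.differentiable x) (hg.differentiable x)]
  rfl

/-- The `L^p` estimate for the equation `Δ w = ∑ₘ ∂ₖ ∂ₗ Fₘ`. -/
theorem exists_integral_rpow_le (hn : n ≠ 0) (ι : Type) [Fintype ι]
    (hpq : p.HolderConjugate q) :
    ∃ K : ℝ, 0 ≤ K ∧ ∀ (k l : ι → Fin n) (F : ι → RSpace n → ℝ) (w : RSpace n → ℝ),
      (∀ m, IsTestFunction (F m)) → IsTestFunction w →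
      (∀ x, lap w x = ∑ m, pderiv (k m) (pderiv (l m) (F m)) x) →
      ∫ x, |w x| ^ p ≤ K * ∑ m, ∫ x, |F m x| ^ p := by
  obtain ⟨C, hC, hb⟩ := exists_bellman hpq
  set N : ℝ := ((Fintype.card ι : ℕ) : ℝ) with hN
  set s : ℝ := C * N + 1 with hs
  have hs0 : 0 < s := by positivity
  refine ⟨C * s ^ p, by positivity, fun k l F w hF hw hlap => ?_⟩
  have key : ∀ ε : ℝ, 0 < ε → s * ∫ x, w x * dualPower p ε w x ≤
      C * (s ^ p * ∑ m, (∫ x, |F m x| ^ p) + N * ∫ x, |dualPower p ε w x| ^ q) := by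
    intro ε hε
    have h := integral_mul_le_sum_rpow hn (k := k) (l := l) (fun m => (hF m).const_mul s)
      (hw.const_mul s) (hw.dualPower hε p) (fun x => by
        simp only [lap, pderiv_const_mul hw, pderiv_const_mul (hw.pderiv _),
          pderiv_const_mul (hF _), pderiv_const_mul ((hF _).pderiv _), ← Finset.mul_sum]
        rw [← hlap x]; rfl) hpq.pos hpq.symm.pos hC hb
    have e1 : ∫ x, s * w x * dualPower p ε w x = s * ∫ x, w x * dualPower p ε w x := by
      rw [← integral_const_mul]; simp only [mul_assoc]
    have e2 : ∀ m, ∫ x, |s * F m x| ^ p = s ^ p * ∫ x, |F m x| ^ p := fun m => by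
      rw [← integral_const_mul]
      congr 1; funext x
      rw [abs_mul, abs_of_pos hs0, Real.mul_rpow hs0.le (abs_nonneg _)]
    simp only [e1, e2, Finset.sum_add_distrib, ← Finset.mul_sum, Finset.sum_const,
      Finset.card_univ, nsmul_eq_mul] at h
    exact h
  obtain ⟨t1, t2⟩ := tendsto_integral_dualPower hpq hw
  have hlim := le_of_tendsto_of_tendsto (t1.const_mul s)
    ((((t2.const_mul N).const_add (s ^ p * ∑ m, ∫ x, |F m x| ^ p)).const_mul C))
    (by filter_upwards [self_mem_nhdsWithin] with ε hε using key ε hε)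
  rw [hs] at hlim ⊢
  linarith

lemma IsTestFunction.memLp {F : Type} [NormedAddCommGroup F] [NormedSpace ℝ F]
    {f : RSpace n → F} (hf : IsTestFunction f) (p : ℝ≥0∞) : MemLp f p :=
  hf.continuous.memLp_of_hasCompactSupport hf.compactSupport

theorem exists_eLpNorm_le (hn : n ≠ 0) (ι : Type) [Fintype ι] {p : ℝ≥0∞} (hp : 1 < p)
    (hp' : p < ⊤) :
    ∃ K : ℝ≥0, ∀ (k l : ι → Fin n) (F : ι → RSpace n → ℝ) (w : RSpace n → ℝ),
      (∀ m, IsTestFunction (F m)) → IsTestFunction w →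
      (∀ x, lap w x = ∑ m, pderiv (k m) (pderiv (l m) (F m)) x) →
      eLpNorm w p volume ≤ K * ∑ m, eLpNorm (F m) p volume := by
  have hp1 : 1 < p.toReal := by
    rw [← ENNReal.toReal_one]; exact (ENNReal.toReal_lt_toReal (by simp) hp'.ne).2 hp
  have hP : 0 < p.toReal := by linarith
  have hp0 : p ≠ 0 := (zero_lt_one.trans hp).ne'
  obtain ⟨K, hK0, hK⟩ := exists_integral_rpow_le hn ι (Real.HolderConjugate.conjExponent hp1)
  set N : ℝ := ((Fintype.card ι : ℕ) : ℝ) with hN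
  refine ⟨Real.toNNReal ((K * N) ^ (p.toReal)⁻¹), fun k l F w hF hw hlap => ?_⟩
  have h := hK k l F w hF hw hlap
  have hI : ∀ f : RSpace n → ℝ, 0 ≤ ∫ x, |f x| ^ p.toReal := fun f =>
    integral_nonneg fun x => by positivity
  set S : ℝ := ∑ m, (∫ x, |F m x| ^ p.toReal) ^ (p.toReal)⁻¹ with hS
  have hS0 : 0 ≤ S := Finset.sum_nonneg fun m _ => Real.rpow_nonneg (hI _) _
  have h1 : ∫ x, |w x| ^ p.toReal ≤ K * N * S ^ p.toReal := by
    refine h.trans ?_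
    rw [mul_assoc]
    refine mul_le_mul_of_nonneg_left ?_ hK0
    have : ∀ m ∈ Finset.univ, ∫ x, |F m x| ^ p.toReal ≤ S ^ p.toReal := fun m hm => by
      have h2 : (∫ x, |F m x| ^ p.toReal) ^ (p.toReal)⁻¹ ≤ S :=
        Finset.single_le_sum (f := fun m => (∫ x, |F m x| ^ p.toReal) ^ (p.toReal)⁻¹)
          (fun m _ => Real.rpow_nonneg (hI _) _) hm
      have h3 := Real.rpow_le_rpow (Real.rpow_nonneg (hI _) _) h2 hP.le
      rwa [← Real.rpow_mul (hI _), inv_mul_cancel₀ hP.ne', Real.rpow_one] at h3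
    simpa [hN] using Finset.sum_le_card_nsmul _ _ _ this
  have h4 : (∫ x, |w x| ^ p.toReal) ^ (p.toReal)⁻¹ ≤ (K * N) ^ (p.toReal)⁻¹ * S := by
    have := Real.rpow_le_rpow (hI w) h1 (inv_nonneg.2 hP.le)
    rwa [Real.mul_rpow (by positivity) (by positivity), ← Real.rpow_mul hS0,
      mul_inv_cancel₀ hP.ne', Real.rpow_one] at this
  have e : ∀ f : RSpace n → ℝ, IsTestFunction f →
      eLpNorm f p volume = ENNReal.ofReal ((∫ x, |f x| ^ p.toReal) ^ (p.toReal)⁻¹) := fun f hf =>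
    (hf.memLp p).eLpNorm_eq_integral_rpow_norm hp0 hp'.ne
  rw [e w hw, Finset.sum_congr rfl fun m _ => e (F m) (hF m),
    ← ENNReal.ofReal_sum_of_nonneg fun m _ => Real.rpow_nonneg (hI _) _]
  change _ ≤ ENNReal.ofReal _ * _
  rw [← ENNReal.ofReal_mul (by positivity)]
  exact ENNReal.ofReal_le_ofReal h4

end Estimate

section Korn

variable {n : ℕ}

/-- The Laplacian of `∂ᵢ vⱼ` in terms of second derivatives of the symmetrized gradient. -/
lemma lap_pderiv_eq {v : Fin n → RSpace n → ℝ} (hv : ∀ j, IsTestFunction (v j)) (i j : Fin n)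
    (x : RSpace n) :
    lap (pderiv i (v j)) x = ∑ m,
      (pderiv m (pderiv m fun y => 1 / 2 * (pderiv i (v j) y + pderiv j (v i) y)) x +
      pderiv m (pderiv i fun y => 1 / 2 * (pderiv j (v m) y + pderiv m (v j) y)) x +
      pderiv m (pderiv j fun y => -(1 / 2) * (pderiv i (v m) y + pderiv m (v i) y)) x) := by
  have h1 : ∀ (c : ℝ) (a b k l : Fin n),
      pderiv a (pderiv b fun y => c * (pderiv k (v l) y + pderiv l (v k) y)) x =
        c * (pderiv a (pderiv b (pderiv k (v l))) x + pderiv a (pderiv b (pderiv l (v k))) x) := by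
    intro c a b k l
    have hk := (hv l).pderiv k
    have hl := (hv k).pderiv l
    rw [pderiv_const_mul (hk.add hl), pderiv_add hk hl,
      pderiv_const_mul ((hk.pderiv b).add (hl.pderiv b)), pderiv_add (hk.pderiv b) (hl.pderiv b)]
  have h2 : ∀ a b l : Fin n, pderiv a (pderiv b (v l)) = pderiv b (pderiv a (v l)) :=
    fun a b l => funext fun y => pderiv_comm (hv l) a b y
  refine Finset.sum_congr rfl fun m _ => ?_
  rw [h1, h1, h1, h2 m j i, h2 i j m, h2 i m j]
  ring

/-- Korn's inequality for one partial derivative of a real vector field. -/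
theorem exists_eLpNorm_pderiv_le {p : ℝ≥0∞} (hp : 1 < p) (hp' : p < ⊤) :
    ∃ K : ℝ≥0, ∀ v : Fin n → RSpace n → ℝ, (∀ j, IsTestFunction (v j)) → ∀ i j : Fin n,
      eLpNorm (pderiv i (v j)) p volume ≤
        K * ∑ k, ∑ l, eLpNorm (fun x => pderiv k (v l) x + pderiv l (v k) x) p volume := by
  rcases eq_or_ne n 0 with rfl | hn
  · exact ⟨0, fun v hv i => i.elim0⟩
  obtain ⟨K, hK⟩ := exists_eLpNorm_le hn (Fin n × Fin 3) hp hp'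
  refine ⟨K * Fintype.card (Fin n × Fin 3), fun v hv i j => ?_⟩
  set S := ∑ k, ∑ l, eLpNorm (fun x => pderiv k (v l) x + pderiv l (v k) x) p volume with hS
  set F : Fin n × Fin 3 → RSpace n → ℝ := fun m =>
    ![fun y => 1 / 2 * (pderiv i (v j) y + pderiv j (v i) y),
      fun y => 1 / 2 * (pderiv j (v m.1) y + pderiv m.1 (v j) y),
      fun y => -(1 / 2) * (pderiv i (v m.1) y + pderiv m.1 (v i) y)] m.2 with hF
  have hT : ∀ k l : Fin n, IsTestFunction fun y => pderiv k (v l) y + pderiv l (v k) y :=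
    fun k l => ((hv l).pderiv k).add ((hv k).pderiv l)
  have h := hK (fun m => m.1) (fun m => ![m.1, i, j] m.2) F (pderiv i (v j))
    (by
      rintro ⟨m, t⟩
      fin_cases t
      · exact (hT i j).const_mul _
      · exact (hT j m).const_mul _
      · exact (hT i m).const_mul _)
    ((hv j).pderiv i)
    (fun x => by
      rw [lap_pderiv_eq hv, Fintype.sum_prod_type]
      simp only [Fin.sum_univ_three]
      rfl)
  have hle : ∀ (c : ℝ) (k l : Fin n), |c| ≤ 1 →
      eLpNorm (fun y => c * (pderiv k (v l) y + pderiv l (v k) y)) p volume ≤ S := by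
    intro c k l hc
    calc _ ≤ eLpNorm (fun y => pderiv k (v l) y + pderiv l (v k) y) p volume := by
          refine eLpNorm_mono fun x => ?_
          rw [norm_mul]
          exact mul_le_of_le_one_left (norm_nonneg _) hc
      _ ≤ ∑ l, eLpNorm (fun y => pderiv k (v l) y + pderiv l (v k) y) p volume :=
          Finset.single_le_sum (f := fun l => eLpNorm (fun y =>
            pderiv k (v l) y + pderiv l (v k) y) p volume) (fun _ _ => zero_le)
            (Finset.mem_univ l)
      _ ≤ S := Finset.single_le_sum (f := fun k => ∑ l, eLpNorm (fun y =>
            pderiv k (v l) y + pderiv l (v k) y) p volume) (fun _ _ => zero_le)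
            (Finset.mem_univ k)
  have h2 : ∑ m, eLpNorm (F m) p volume ≤ Fintype.card (Fin n × Fin 3) * S := by
    have : ∀ m ∈ Finset.univ, eLpNorm (F m) p volume ≤ S := by
      rintro ⟨m, t⟩ -
      have hh : |(1 / 2 : ℝ)| ≤ 1 := by norm_num
      have hh' : |(-(1 / 2) : ℝ)| ≤ 1 := by norm_num
      fin_cases t
      · exact hle _ i j hh
      · exact hle _ j m hh
      · exact hle _ i m hh'
    simpa using Finset.sum_le_card_nsmul _ _ _ this
  calc _ ≤ _ := h
    _ ≤ K * (Fintype.card (Fin n × Fin 3) * S) := by gcongr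
    _ = _ := by push_cast; ring

lemma pderiv_clm_comp {E F : Type} [NormedAddCommGroup E] [NormedSpace ℝ E]
    [NormedAddCommGroup F] [NormedSpace ℝ F] {f : RSpace n → E} (hf : IsTestFunction f)
    (L : E →L[ℝ] F) (i : Fin n) (x : RSpace n) :
    pderiv i (fun y => L (f y)) x = L (pderiv i f x) := by
  have := L.hasFDerivAt.comp x (hf.differentiable x).hasFDerivAt
  exact congrArg (fun T => T (EuclideanSpace.single i (1 : ℝ))) this.fderiv

/-- The coordinate maps of `ℂ^ν` as real-linear maps. -/
noncomputable def coordCLM {ν : Type} [Fintype ν] (j : ν) : CSpace ν →L[ℝ] ℂ :=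
  (EuclideanSpace.proj (𝕜 := ℂ) j).restrictScalars ℝ

lemma pderiv_coord {ν : Type} [Fintype ν] {u : RSpace n → CSpace ν} (hu : IsTestFunction u)
    (i : Fin n) (j : ν) (x : RSpace n) : pderiv i (fun y => u y j) x = pderiv i u x j :=
  pderiv_clm_comp hu (coordCLM j) i x

lemma IsTestFunction.coord {ν : Type} [Fintype ν] {u : RSpace n → CSpace ν}
    (hu : IsTestFunction u) (j : ν) : IsTestFunction fun x => u x j :=
  hu.clm_comp (coordCLM j)

/-- **Korn's inequality**. -/
theorem korn {p : ℝ≥0∞} (hp : 1 < p) (hp' : p < ⊤) :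
    ∃ C : ℝ≥0, ∀ u : RSpace n → CSpace (Fin n), IsTestFunction u →
      ∑ i, ∑ j, eLpNorm (pderiv i fun x => u x j) p volume ≤
        C * ∑ i, ∑ j, eLpNorm (fun x => pderiv i (fun y => u y j) x +
          pderiv j (fun y => u y i) x) p volume := by
  obtain ⟨K, hK⟩ := exists_eLpNorm_pderiv_le (n := n) hp hp'
  refine ⟨n * (n * (2 * K)), fun u hu => ?_⟩
  set S := ∑ i, ∑ j, eLpNorm (fun x => pderiv i (fun y => u y j) x +
          pderiv j (fun y => u y i) x) p volume with hS
  have hpart : ∀ L : ℂ →L[ℝ] ℝ, (∀ z, |L z| ≤ ‖z‖) → ∀ i j : Fin n,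
      eLpNorm (fun x => L (pderiv i (fun y => u y j) x)) p volume ≤ K * S := by
    intro L hL i j
    have hc := fun (k l : Fin n) (x : RSpace n) => pderiv_clm_comp (hu.coord l) L k x
    have h := hK (fun l x => L (u x l)) (fun l => (hu.coord l).clm_comp L) i j
    have e : pderiv i (fun x => L (u x j)) = fun x => L (pderiv i (fun y => u y j) x) :=
      funext (hc i j)
    rw [e] at h
    refine h.trans (mul_le_mul_right (Finset.sum_le_sum fun k _ => Finset.sum_le_sum
      fun l _ => eLpNorm_mono fun x => ?_) _)
    rw [hc, hc, ← map_add]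
    exact hL _
  have hone : ∀ i j : Fin n, eLpNorm (pderiv i fun x => u x j) p volume ≤ 2 * K * S := by
    intro i j
    have hT := (hu.coord j).pderiv i
    have hre := hpart Complex.reCLM Complex.abs_re_le_norm i j
    have him := hpart Complex.imCLM Complex.abs_im_le_norm i j
    calc eLpNorm (pderiv i fun x => u x j) p volume
        ≤ eLpNorm (fun x => |Complex.reCLM (pderiv i (fun y => u y j) x)| +
            |Complex.imCLM (pderiv i (fun y => u y j) x)|) p volume :=
          eLpNorm_mono_real fun x => Complex.norm_le_abs_re_add_abs_im _
      _ ≤ eLpNorm (fun x => |Complex.reCLM (pderiv i (fun y => u y j) x)|) p volume +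
          eLpNorm (fun x => |Complex.imCLM (pderiv i (fun y => u y j) x)|) p volume :=
          eLpNorm_add_le
            (hT.clm_comp Complex.reCLM).continuous.abs.aestronglyMeasurable
            (hT.clm_comp Complex.imCLM).continuous.abs.aestronglyMeasurable hp.le
      _ ≤ K * S + K * S := add_le_add
          ((eLpNorm_norm fun x => Complex.reCLM (pderiv i (fun y => u y j) x)).trans_le hre)
          ((eLpNorm_norm fun x => Complex.imCLM (pderiv i (fun y => u y j) x)).trans_le him)
      _ = _ := by ring
  calc ∑ i, ∑ j, eLpNorm (pderiv i fun x => u x j) p volume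
      ≤ ∑ _i : Fin n, ∑ _j : Fin n, 2 * K * S :=
        Finset.sum_le_sum fun i _ => Finset.sum_le_sum fun j _ => hone i j
    _ = _ := by simp; ring

end Korn

section Symbol

variable {n : ℕ}

lemma gradCoeff_apply (j : Fin n) (v : CSpace (Fin n)) (k l : Fin n) :
    gradCoeff n j v (k, l) = if k = j then Complex.I * v l else 0 := rfl

lemma symmetrizer_apply (w : CSpace (Fin n × Fin n)) (k l : Fin n) :
    symmetrizer n w (k, l) = w (k, l) + w (l, k) := rfl

lemma sum_gradCoeff_apply (v : Fin n → CSpace (Fin n)) (k l : Fin n) :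
    (∑ j, gradCoeff n j (v j)) (k, l) = Complex.I * v k l := by
  rw [WithLp.ofLp_sum, Finset.sum_apply]
  simp [gradCoeff_apply]

lemma symbol_gradCoeff_apply (ξ : RSpace n) (v : CSpace (Fin n)) (k l : Fin n) :
    symbol (gradCoeff n) ξ v (k, l) = Complex.I * (ξ k * v l) := by
  have : symbol (gradCoeff n) ξ v = ∑ j, gradCoeff n j ((ξ j : ℂ) • v) := by
    simp [symbol]
  rw [this, sum_gradCoeff_apply]
  simp

lemma diffOp_gradCoeff_apply {u : RSpace n → CSpace (Fin n)} (hu : IsTestFunction u)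
    (x : RSpace n) (i j : Fin n) :
    diffOp (gradCoeff n) u x (i, j) = pderiv i (fun y => u y j) x := by
  rw [pderiv_coord hu, diffOp, PiLp.smul_apply, sum_gradCoeff_apply, smul_eq_mul, ← mul_assoc]
  simp

lemma norm_symbol_sq (ξ : RSpace n) (v : CSpace (Fin n)) :
    ‖symbol (gradCoeff n) ξ v‖ ^ 2 = ‖ξ‖ ^ 2 * ‖v‖ ^ 2 := by
  rw [EuclideanSpace.norm_sq_eq, EuclideanSpace.norm_sq_eq, EuclideanSpace.norm_sq_eq,
    Fintype.sum_prod_type, Finset.sum_mul_sum]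
  simp [symbol_gradCoeff_apply, mul_pow]

lemma norm_symmetrizer_symbol_sq (ξ : RSpace n) (v : CSpace (Fin n)) :
    ‖symmetrizer n (symbol (gradCoeff n) ξ v)‖ ^ 2 =
      2 * (‖ξ‖ ^ 2 * ‖v‖ ^ 2 + ‖∑ i, (ξ i : ℂ) * v i‖ ^ 2) := by
  have hpt : ∀ k l : Fin n, ‖symmetrizer n (symbol (gradCoeff n) ξ v) (k, l)‖ ^ 2 =
      ξ k ^ 2 * ‖v l‖ ^ 2 + ξ l ^ 2 * ‖v k‖ ^ 2 +
        2 * (((ξ k : ℂ) * v k) * (starRingEnd ℂ) ((ξ l : ℂ) * v l)).re := by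
    intro k l
    rw [symmetrizer_apply, symbol_gradCoeff_apply, symbol_gradCoeff_apply, ← mul_add, norm_mul,
      Complex.norm_I, one_mul, ← Complex.normSq_eq_norm_sq, ← Complex.normSq_eq_norm_sq,
      ← Complex.normSq_eq_norm_sq]
    simp [Complex.normSq_apply]
    ring
  have hcross : ∑ k, ∑ l, (((ξ k : ℂ) * v k) * (starRingEnd ℂ) ((ξ l : ℂ) * v l)).re =
      ‖∑ i, (ξ i : ℂ) * v i‖ ^ 2 := by
    rw [← Complex.normSq_eq_norm_sq, ← Complex.ofReal_re (Complex.normSq _),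
      ← Complex.mul_conj, map_sum, Finset.sum_mul_sum, Complex.re_sum]
    exact Finset.sum_congr rfl fun k _ => (Complex.re_sum _ _).symm
  rw [EuclideanSpace.norm_sq_eq, Fintype.sum_prod_type]
  simp only [hpt, Finset.sum_add_distrib, ← Finset.mul_sum, hcross]
  have e : ∑ k, ξ k ^ 2 * ∑ l, ‖v l‖ ^ 2 = ‖ξ‖ ^ 2 * ‖v‖ ^ 2 := by
    rw [EuclideanSpace.norm_sq_eq, EuclideanSpace.norm_sq_eq, Finset.sum_mul]
    simp
  have e' : ∑ k : Fin n, ∑ l, ξ l ^ 2 * ‖v k‖ ^ 2 = ‖ξ‖ ^ 2 * ‖v‖ ^ 2 := by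
    rw [Finset.sum_comm, ← e]
    simp only [Finset.mul_sum]
  rw [e, e']
  ring

lemma two_mul_norm_symbol_sq_le (ξ : RSpace n) (v : CSpace (Fin n)) :
    2 * ‖symbol (gradCoeff n) ξ v‖ ^ 2 ≤ ‖symmetrizer n (symbol (gradCoeff n) ξ v)‖ ^ 2 := by
  rw [norm_symbol_sq, norm_symmetrizer_symbol_sq]
  nlinarith [sq_nonneg ‖∑ i, (ξ i : ℂ) * v i‖]

theorem hasConstantRank_gradCoeff : HasConstantRank (gradCoeff n) n := by
  intro ξ hξ
  have hinj : Function.Injective (symbol (gradCoeff n) ξ).toLinearMap := by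
    rw [injective_iff_map_eq_zero]
    intro v hv
    have h : ‖symbol (gradCoeff n) ξ v‖ ^ 2 = 0 := by
      rw [show symbol (gradCoeff n) ξ v = 0 from hv]; simp
    rw [norm_symbol_sq] at h
    simpa [hξ] using h
  rw [LinearMap.finrank_range_of_inj hinj]
  simp

theorem symbolCoercive_symmetrizer :
    SymbolCoercive (fun _ => symmetrizer n) (gradCoeff n) := by
  refine ⟨1, one_pos, Filter.Eventually.of_forall fun _ ξ v => ?_⟩
  rw [one_mul]
  refine le_of_sq_le_sq ?_ (norm_nonneg _)
  nlinarith [two_mul_norm_symbol_sq_le ξ v, sq_nonneg ‖symbol (gradCoeff n) ξ v‖]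

theorem lpCoercive_symmetrizer {p : ℝ≥0∞} (hp : 1 < p) (hp' : p < ⊤) :
    LpCoercive p (fun _ => symmetrizer n) (gradCoeff n) := by
  obtain ⟨C, hC⟩ := korn (n := n) hp hp'
  refine ⟨C * (n * n), fun u hu => ?_⟩
  have hcont : ∀ i j : Fin n, Continuous (pderiv i fun x => u x j) := fun i j =>
    ((hu.coord j).pderiv i).continuous
  have h1 : eLpNorm (diffOp (gradCoeff n) u) p volume ≤
      ∑ i, ∑ j, eLpNorm (pderiv i fun x => u x j) p volume := by
    calc eLpNorm (diffOp (gradCoeff n) u) p volume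
        ≤ eLpNorm (∑ k : Fin n × Fin n, fun x => ‖pderiv k.1 (fun y => u y k.2) x‖) p volume := by
          refine eLpNorm_mono_real fun x => ?_
          rw [Finset.sum_apply]
          refine le_of_sq_le_sq ?_ (Finset.sum_nonneg fun _ _ => norm_nonneg _)
          rw [EuclideanSpace.norm_sq_eq]
          refine le_of_eq_of_le (Finset.sum_congr rfl fun k _ => ?_)
            (Finset.sum_sq_le_sq_sum_of_nonneg fun _ _ => norm_nonneg _)
          rw [← diffOp_gradCoeff_apply hu x k.1 k.2]
      _ ≤ ∑ k : Fin n × Fin n,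
            eLpNorm (fun x => ‖pderiv k.1 (fun y => u y k.2) x‖) p volume :=
          eLpNorm_sum_le (fun k _ => (hcont k.1 k.2).norm.aestronglyMeasurable) hp.le
      _ = _ := by
          rw [Fintype.sum_prod_type]
          simp only [eLpNorm_norm]
  have h2 : ∀ i j : Fin n, eLpNorm (fun x => pderiv i (fun y => u y j) x +
      pderiv j (fun y => u y i) x) p volume ≤
        eLpNorm (fun x => symmetrizer n (diffOp (gradCoeff n) u x)) p volume := fun i j => by
    refine eLpNorm_mono fun x => ?_
    rw [← diffOp_gradCoeff_apply hu x i j, ← diffOp_gradCoeff_apply hu x j i,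
      ← symmetrizer_apply]
    exact PiLp.norm_apply_le _ (i, j)
  calc eLpNorm (diffOp (gradCoeff n) u) p volume ≤ _ := h1
    _ ≤ _ := hC u hu
    _ ≤ C * ∑ _i : Fin n, ∑ _j : Fin n,
          eLpNorm (fun x => symmetrizer n (diffOp (gradCoeff n) u x)) p volume :=
        mul_le_mul_right (Finset.sum_le_sum fun i _ => Finset.sum_le_sum fun j _ => h2 i j) _
    _ = _ := by simp; ring

theorem exists_sum_gradCoeff_eq (w : CSpace (Fin n × Fin n)) :
    ∃ v : Fin n → CSpace (Fin n), ∑ j, gradCoeff n j (v j) = w := by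
  refine ⟨fun j => WithLp.toLp 2 fun l => -Complex.I * w (j, l), ?_⟩
  ext ⟨k, l⟩
  rw [sum_gradCoeff_apply, ← mul_assoc]
  simp

theorem symmetrizer_eq_zero {w : CSpace (Fin n × Fin n)} (hw : ∀ i j, w (j, i) = -w (i, j)) :
    symmetrizer n w = 0 := by
  ext ⟨k, l⟩
  rw [symmetrizer_apply, hw k l]
  simp

theorem not_pointwiseCoercive_symmetrizer (hn : 2 ≤ n) :
    ¬ PointwiseCoercive (fun _ => symmetrizer n) (gradCoeff n) := by
  rintro ⟨c, hc, h⟩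
  obtain ⟨x, hx⟩ := h.exists
  set a : Fin n := ⟨0, by omega⟩
  set b : Fin n := ⟨1, by omega⟩
  have hab : a ≠ b := by simp [a, b]
  set w : CSpace (Fin n × Fin n) :=
    EuclideanSpace.single (a, b) 1 - EuclideanSpace.single (b, a) 1 with hw
  have hanti : ∀ i j, w (j, i) = -w (i, j) := by
    intro i j
    simp only [hw, PiLp.sub_apply, PiLp.single_apply, Prod.mk.injEq, neg_sub]
    congr 1 <;> simp only [and_comm]
  have hwab : w (a, b) = 1 := by simp [hw, hab]
  obtain ⟨v, hv⟩ := exists_sum_gradCoeff_eq w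
  have h1 := hx v
  rw [hv, symmetrizer_eq_zero hanti, norm_zero] at h1
  have h2 : 1 ≤ ‖w‖ := by simpa [hwab] using PiLp.norm_apply_le w (a, b)
  nlinarith

end Symbol

end Coercivity
theorem mainTheorem7 (n : ℕ) :
    -- Korn's inequality
    (∀ p : ℝ≥0∞, 1 < p → p < ⊤ → ∃ C : ℝ≥0,
      ∀ u : Coercivity.RSpace n → Coercivity.CSpace (Fin n), Coercivity.IsTestFunction u →
        ∑ i, ∑ j, eLpNorm (Coercivity.pderiv i fun x => u x j) p volume ≤
          C * ∑ i, ∑ j, eLpNorm (fun x => Coercivity.pderiv i (fun y => u y j) x +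
            Coercivity.pderiv j (fun y => u y i) x) p volume) ∧
    -- in terms of `D = ∇⊗` and the symmetrizer `A`: the components of `Du` and `ADu`
    (∀ u : Coercivity.RSpace n → Coercivity.CSpace (Fin n), Coercivity.IsTestFunction u →
      ∀ (x : Coercivity.RSpace n) (i j : Fin n),
        Coercivity.diffOp (Coercivity.gradCoeff n) u x (i, j) =
          Coercivity.pderiv i (fun y => u y j) x ∧
        Coercivity.symmetrizer n (Coercivity.diffOp (Coercivity.gradCoeff n) u x) (i, j) =
          Coercivity.pderiv i (fun y => u y j) x + Coercivity.pderiv j (fun y => u y i) x) ∧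
    -- the symbol of `D` has constant rank
    Coercivity.HasConstantRank (Coercivity.gradCoeff n) n ∧
    -- the computation for the symbol of `AD`, and the resulting symbol condition
    (∀ (ξ : Coercivity.RSpace n) (v : Coercivity.CSpace (Fin n)),
      ‖Coercivity.symmetrizer n (Coercivity.symbol (Coercivity.gradCoeff n) ξ v)‖ ^ 2 =
          2 * (‖ξ‖ ^ 2 * ‖v‖ ^ 2 + ‖∑ i, (ξ i : ℂ) * v i‖ ^ 2) ∧
      ‖Coercivity.symbol (Coercivity.gradCoeff n) ξ v‖ ^ 2 = ‖ξ‖ ^ 2 * ‖v‖ ^ 2 ∧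
      2 * ‖Coercivity.symbol (Coercivity.gradCoeff n) ξ v‖ ^ 2 ≤
        ‖Coercivity.symmetrizer n (Coercivity.symbol (Coercivity.gradCoeff n) ξ v)‖ ^ 2) ∧
    Coercivity.SymbolCoercive (fun _ => Coercivity.symmetrizer n) (Coercivity.gradCoeff n) ∧
    -- the coercivity estimate
    (∀ p : ℝ≥0∞, 1 < p → p < ⊤ →
      Coercivity.LpCoercive p (fun _ => Coercivity.symmetrizer n) (Coercivity.gradCoeff n)) ∧
    -- the pointwise condition fails: the vectors `∑ⱼ D̂ⱼ vⱼ` exhaust the whole space, and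
    -- `A` annihilates the antisymmetric ones
    (∀ w : Coercivity.CSpace (Fin n × Fin n), ∃ v : Fin n → Coercivity.CSpace (Fin n),
      ∑ j, Coercivity.gradCoeff n j (v j) = w) ∧
    (∀ w : Coercivity.CSpace (Fin n × Fin n), (∀ i j, w (j, i) = -w (i, j)) →
      Coercivity.symmetrizer n w = 0) ∧
    (2 ≤ n → ¬ Coercivity.PointwiseCoercive (fun _ => Coercivity.symmetrizer n)
      (Coercivity.gradCoeff n)) :=
  ⟨fun _ hp hp' => Coercivity.korn hp hp',
    fun _ hu x i j => ⟨Coercivity.diffOp_gradCoeff_apply hu x i j, by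
      rw [Coercivity.symmetrizer_apply, Coercivity.diffOp_gradCoeff_apply hu x i j,
        Coercivity.diffOp_gradCoeff_apply hu x j i]⟩,
    Coercivity.hasConstantRank_gradCoeff,
    fun ξ v => ⟨Coercivity.norm_symmetrizer_symbol_sq ξ v, Coercivity.norm_symbol_sq ξ v,
      Coercivity.two_mul_norm_symbol_sq_le ξ v⟩,
    Coercivity.symbolCoercive_symmetrizer,
    fun _ hp hp' => Coercivity.lpCoercive_symmetrizer hp hp',
    Coercivity.exists_sum_gradCoeff_eq,
    fun _ hw => Coercivity.symmetrizer_eq_zero hw,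
    Coercivity.not_pointwiseCoercive_symmetrizer⟩
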